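/- Let $d\in\mathbb N$ and consider the fermionic chain with one-particle space $\ell^2_d(\mathbb Z)=\ell^2(\mathbb Z)\otimes\mathbb C^d$. Let $\mathbf q,\mathbf r$ be measurable functions on the torus $\mathbb T=[0,2\pi)$ with values in $\mathbb C^{d\times d}$ such that for some $c\in(0,1/2)$ $$cI_d\le \mathbf q(x),\mathbf r(x)\le (1-c)I_d\qquad\text{for a.e. }x\in\mathbb T,$$ and let $Q=F^{-1}M_{\mathbf q}F$, $R=F^{-1}M_{\mathbf r}F$ be the corresponding translation-invariant (block Toeplitz) operators on $\ell^2_d(\mathbb Z)$, where $F\,(1_{\{k\}}\otimes v)=\tfrac1{\sqrt{2\pi}}e^{ik(\cdot)}v$ is the Fourier transform and $M$ denotes multiplication. Let $\omega_Q,\omega_R$ be the (translation- and gauge-invariant) quasi-free states with symbols $Q,R$. For a matrix $0\le S\le I$ acting on $\mathbb C^N$, let $\widehat\omega_S=\prod_j\big(s_j\,a(e_j)^*a(e_j)+(1-s_j)\,a(e_j)a(e_j)^*\big)$, where $S=\sum_j s_j|e_j\rangle\langle e_j|$ is an eigen-decomposition, be the density operator, on the antisymmetric Fock space of $\mathbb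 C^N$, of the gauge-invariant quasi-free state with symbol $S$. Let $Q_n,R_n$ be the compressions of $Q,R$ to the sites $0,\dots,n-1$, so that $\widehat\omega_{Q_n},\widehat\omega_{R_n}$ are the densities of the restrictions of $\omega_Q,\omega_R$ to these sites. For positive definite $A,B$, $\alpha>0$ and $\gamma\in(0,+\infty]\cup\{\max\}$, let $$\mathcal Q^{\rm op}_{\alpha,z}(A\|B)=\big(A^{\frac{\alpha}{2z}}B^{\frac{1-\alpha}{z}}A^{\frac{\alpha}{2z}}\big)^z\ (0<z<\infty),\qquad \mathcal Q^{\rm op}_{\alpha,+\infty}(A\|B)=e^{\alpha\log A+(1-\alpha)\log B},$$ $$\mathcal Q^{\rm op}_{\alpha,\max}(A\|B)=B^{1/2}\big(B^{-1/2}AB^{-1/2}\big)^{\alpha}B^{1/2},$$ $\psi_{\alpha,\gamma}(A\|B)=\log\operatorname{Tr}\mathcal Q^{\rm op}_{\alpha,\gamma}(A\|B)$, and $D_{\alpha,\gamma}=\frac1{\alpha-1}\psi_{\alpha,\gamma}$ for $\alpha\ne1$; for $\alpha=1$ let $D_{1,\gamma}(A\|B)=\operatorname{Tr}A(\log A-\log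 B)$ if $\gamma\in(0,+\infty]$, and $D_{1,\max}(A\|B)=\operatorname{Tr}A\log(A^{1/2}B^{-1}A^{1/2})$. (For $\gamma=z\in(0,\infty)$, $\gamma=+\infty$ and $\gamma=\max$ these are the Rényi $(\alpha,z)$-, log-Euclidean and maximal Rényi divergences.) For matrices $S,T$ with spectra in $(0,1)$, write $W_S=S(I-S)^{-1}$ and $$\psi^{\rm qf}_{\alpha,\gamma}(S\|T)=\alpha\operatorname{Tr}\log(I-S)+(1-\alpha)\operatorname{Tr}\log(I-T)+\operatorname{Tr}\log\big(I+\mathcal Q^{\rm op}_{\alpha,\gamma}(W_S\|W_T)\big),$$ $D^{\rm qf}_{\alpha,\gamma}=\frac1{\alpha-1}\psi^{\rm qf}_{\alpha,\gamma}$ for $\alpha\neq1$, and $$D^{\rm qf}_{1,\gamma}(S\|T)=\operatorname{Tr}\big[S(\log S-\log T)+(I-S)(\log(I-S)-\log(I-T))\big]\quad(\gamma\in(0,+\infty]),$$ $$D^{\rm qf}_{1,\max}(S\|T)=\operatorname{Tr}\big[\log(I-S)-\log(I-T)+S\log\big(W_S^{1/2}W_T^{-1}W_S^{1/2}\big)\big].$$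 Then for every $\alpha>0$ and $\gamma\in(0,+\infty]\cup\{\max\}$ the functions $x\mapsto\psi_{\alpha,\gamma}(\widehat\omega_{\mathbf q(x)}\|\widehat\omega_{\mathbf r(x)})$ and $x\mapsto D_{\alpha,\gamma}(\widehat\omega_{\mathbf q(x)}\|\widehat\omega_{\mathbf r(x)})$ are integrable on $\mathbb T$, the limits $\psi^{\rm reg}_{\alpha,\gamma}(\omega_Q\|\omega_R):=\lim_n\frac1n\psi_{\alpha,\gamma}(\widehat\omega_{Q_n}\|\widehat\omega_{R_n})$ and $D^{\rm reg}_{\alpha,\gamma}(\omega_Q\|\omega_R):=\lim_n\frac1nD_{\alpha,\gamma}(\widehat\omega_{Q_n}\|\widehat\omega_{R_n})$ exist, and $$\psi^{\rm reg}_{\alpha,\gamma}(\omega_Q\|\omega_R)=\frac1{2\pi}\int_0^{2\pi}\psi_{\alpha,\gamma}(\widehat\omega_{\mathbf q(x)}\|\widehat\omega_{\mathbf r(x)})\,dx=\frac1{2\pi}\int_0^{2\pi}\psi^{\rm qf}_{\alpha,\gamma}(\mathbf q(x)\|\mathbf r(x))\,dx$$ $$=\frac1{2\pi}\int_0^{2\pi}\operatorname{Tr}\Big[\log(I_d-\mathbf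 q(x))^{\alpha}+\log(I_d-\mathbf r(x))^{1-\alpha}+\log\big(I_d+\mathcal Q^{\rm op}_{\alpha,\gamma}(W_{\mathbf q(x)}\|W_{\mathbf r(x)})\big)\Big]dx,$$ $$D^{\rm reg}_{\alpha,\gamma}(\omega_Q\|\omega_R)=\frac1{2\pi}\int_0^{2\pi}D_{\alpha,\gamma}(\widehat\omega_{\mathbf q(x)}\|\widehat\omega_{\mathbf r(x)})\,dx=\frac1{2\pi}\int_0^{2\pi}D^{\rm qf}_{\alpha,\gamma}(\mathbf q(x)\|\mathbf r(x))\,dx,$$ and, for $\alpha\ne1$, the last quantity also equals $$\frac1{2\pi}\int_0^{2\pi}\frac1{\alpha-1}\operatorname{Tr}\Big[\log(I_d-\mathbf q(x))^{\alpha}+\log(I_d-\mathbf r(x))^{1-\alpha}+\log\big(I_d+\mathcal Q^{\rm op}_{\alpha,\gamma}(W_{\mathbf q(x)}\|W_{\mathbf r(x)})\big)\Big]dx.$$ Here $\log(\cdot)^{\beta}$ means $\log\big((\cdot)^{\beta}\big)$. -/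

import Mathlib

open scoped Matrix Topology ComplexOrder
open Filter MeasureTheory

namespace FermiChain

noncomputable section

/-! ### Functional calculus and Rényi quantities of matrices -/

section Renyi

variable {ι : Type*} [Fintype ι] [DecidableEq ι]

/-- The real power `A ^ p` of a Hermitian matrix (used for positive definite `A`). -/
def mpow (A : Matrix ι ι ℂ) (p : ℝ) : Matrix ι ι ℂ := cfc (fun t : ℝ => t ^ p) A

/-- The logarithm of a Hermitian matrix (used for positive definite matrices). -/
def mlog (A : Matrix ι ι ℂ) : Matrix ι ι ℂ := cfc Real.log A

/-- The exponential of a Hermitian matrix. -/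
def mexp (A : Matrix ι ι ℂ) : Matrix ι ι ℂ := cfc Real.exp A

/-- The trace, as a real number (all traces below are traces of matrices with real trace). -/
def rtr (A : Matrix ι ι ℂ) : ℝ := (Matrix.trace A).re

/-- The second parameter `γ ∈ (0, +∞] ∪ {max}` of the Rényi quantities. -/
inductive RenyiIndex : Type
  | finite (z : ℝ) (hz : 0 < z) : RenyiIndex
  | infinity : RenyiIndex
  | maximal : RenyiIndex

/-- The operators `Q^op_{α,γ}(A‖B)`:
`(A^{α/2z} B^{(1-α)/z} A^{α/2z})^z`, `exp (α log A + (1-α) log B)`, and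
`B^{1/2} (B^{-1/2} A B^{-1/2})^α B^{1/2}`. -/
def renyiOp (α : ℝ) (γ : RenyiIndex) (A B : Matrix ι ι ℂ) : Matrix ι ι ℂ :=
  match γ with
  | .finite z _ =>
      mpow (mpow A (α / (2 * z)) * mpow B ((1 - α) / z) * mpow A (α / (2 * z))) z
  | .infinity => mexp (α • mlog A + (1 - α) • mlog B)
  | .maximal =>
      mpow B (1 / 2) * mpow (mpow B (-(1 / 2)) * A * mpow B (-(1 / 2))) α * mpow B (1 / 2)

/-- `ψ_{α,γ}(A‖B) = log Tr Q^op_{α,γ}(A‖B)`. -/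
def psi (α : ℝ) (γ : RenyiIndex) (A B : Matrix ι ι ℂ) : ℝ :=
  Real.log (rtr (renyiOp α γ A B))

/-- The Umegaki relative entropy `Tr A (log A - log B)`. -/
def umegaki (A B : Matrix ι ι ℂ) : ℝ := rtr (A * (mlog A - mlog B))

/-- The Belavkin–Staszewski relative entropy `Tr A log (A^{1/2} B⁻¹ A^{1/2})`. -/
def belavkinStaszewski (A B : Matrix ι ι ℂ) : ℝ :=
  rtr (A * mlog (mpow A (1 / 2) * B⁻¹ * mpow A (1 / 2)))

/-- The Rényi divergence `D_{α,γ}(A‖B) = ψ_{α,γ}(A‖B) / (α - 1)` for `α ≠ 1`; for `α = 1` it is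
the Umegaki relative entropy if `γ ∈ (0, +∞]` and the Belavkin–Staszewski relative entropy if
`γ = max`. -/
def renyiD (α : ℝ) (γ : RenyiIndex) (A B : Matrix ι ι ℂ) : ℝ :=
  if α = 1 then
    match γ with
    | .maximal => belavkinStaszewski A B
    | _ => umegaki A B
  else 1 / (α - 1) * psi α γ A B

/-- The weight `Q / (I - Q)` of a symbol. -/
def weight (Q : Matrix ι ι ℂ) : Matrix ι ι ℂ := Q * (1 - Q)⁻¹

/-- `ψ^qf_{α,γ}(Q‖R)`, the trace-log expression in terms of the symbols. -/
def psiQf (α : ℝ) (γ : RenyiIndex) (Q R : Matrix ι ι ℂ) : ℝ :=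
  α * rtr (mlog (1 - Q)) + (1 - α) * rtr (mlog (1 - R))
    + rtr (mlog (1 + renyiOp α γ (weight Q) (weight R)))

/-- The Umegaki relative entropy of quasi-free states in terms of the symbols. -/
def umegakiQf (Q R : Matrix ι ι ℂ) : ℝ :=
  rtr (Q * (mlog Q - mlog R) + (1 - Q) * (mlog (1 - Q) - mlog (1 - R)))

/-- The Belavkin–Staszewski relative entropy of quasi-free states in terms of the symbols. -/
def belavkinStaszewskiQf (Q R : Matrix ι ι ℂ) : ℝ :=
  rtr (mlog (1 - Q) - mlog (1 - R)
    + Q * mlog (mpow (weight Q) (1 / 2) * (weight R)⁻¹ * mpow (weight Q) (1 / 2)))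

/-- `D^qf_{α,γ}(Q‖R)`, the Rényi divergence in terms of the symbols. -/
def renyiDQf (α : ℝ) (γ : RenyiIndex) (Q R : Matrix ι ι ℂ) : ℝ :=
  if α = 1 then
    match γ with
    | .maximal => belavkinStaszewskiQf Q R
    | _ => umegakiQf Q R
  else 1 / (α - 1) * psiQf α γ Q R

/-- The explicit integrand
`Tr [log (I - Q)^α + log (I - R)^{1-α} + log (I + Q^op_{α,γ}(Q/(I-Q) ‖ R/(I-R)))]`. -/
def traceLog (α : ℝ) (γ : RenyiIndex) (Q R : Matrix ι ι ℂ) : ℝ :=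
  rtr (mlog (mpow (1 - Q) α) + mlog (mpow (1 - R) (1 - α))
    + mlog (1 + renyiOp α γ (weight Q) (weight R)))

end Renyi

/-! ### Finite fermionic systems

For a finite linearly ordered set `ι` of modes, the antisymmetric Fock space over `ℂ^ι` has the
orthonormal basis `e_S = e_{i₁} ∧ ⋯ ∧ e_{iₖ}`, indexed by `S = {i₁ < ⋯ < iₖ} ⊆ ι`; operators on
it are written as matrices in this basis. -/

section Fock

variable {ι : Type*} [Fintype ι] [LinearOrder ι]

/-- Creation operator of a basis mode: `e_T ↦ e_i ∧ e_T`, which is `± e_{T ∪ {i}}`, with the sign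
given by the number of elements of `T` below `i`, if `i ∉ T`, and `0` if `i ∈ T`. -/
def cre (i : ι) : Matrix (Finset ι) (Finset ι) ℂ :=
  Matrix.of fun S T =>
    if i ∉ T ∧ S = insert i T then (-1) ^ (T.filter (· < i)).card else 0

/-- The creation operator `c(φ) = a(φ)*`, linear in `φ ∈ ℂ^ι`. -/
def creation (φ : ι → ℂ) : Matrix (Finset ι) (Finset ι) ℂ := ∑ i, φ i • cre i

/-- The annihilation operator `a(φ)`, the adjoint of `c(φ)`. -/
def annihilation (φ : ι → ℂ) : Matrix (Finset ι) (Finset ι) ℂ := (creation φ)ᴴ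

/-- The density operator of the (gauge-invariant) quasi-free state with symbol `Q` on the CAR
algebra over `ℂ^ι`, that is, `∏_j (q_j a(e_j)* a(e_j) + (1 - q_j) a(e_j) a(e_j)*)` for an
eigen-decomposition `Q = ∑_j q_j |e_j⟩⟨e_j|`. The factors commute. -/
def qfDensity (Q : Matrix ι ι ℂ) : Matrix (Finset ι) (Finset ι) ℂ :=
  if hQ : Q.IsHermitian then
    ((Finset.univ : Finset ι).sort.map fun j =>
      (hQ.eigenvalues j : ℂ) •
          (creation (hQ.eigenvectorBasis j) * annihilation (hQ.eigenvectorBasis j))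
        + (1 - (hQ.eigenvalues j : ℂ)) •
          (annihilation (hQ.eigenvectorBasis j) * creation (hQ.eigenvectorBasis j))).prod
  else 0

end Fock

/-! ### Consistency of the density operator

The operators above satisfy the canonical anti-commutation relations, and for `0 ≤ Q ≤ I` the
matrix `qfDensity Q` is a density operator whose expectations are those of the quasi-free state
with symbol `Q`: the expectation of `a(φ₁)* ⋯ a(φ_n)* a(ψ_m) ⋯ a(ψ₁)` is
`δ_{mn} det ⟨ψ_i, Q φ_j⟩` (see `qfDensity_wick`, `qfDensity_wick_ne`, `trace_qfDensity`,
`posSemidef_qfDensity`). -/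

section FockLemmas

set_option linter.unusedSectionVars false

variable {ι : Type*} [Fintype ι] [LinearOrder ι]

/-- The sign in the creation operator of a basis mode. -/
def jwSign (i : ι) (T : Finset ι) : ℂ := (-1) ^ (T.filter (· < i)).card

lemma jwSign_mul_self (i : ι) (T : Finset ι) : jwSign i T * jwSign i T = 1 := by
  unfold jwSign; rw [← mul_pow]; simp

lemma jwSign_erase_self (i : ι) (T : Finset ι) : jwSign i (T.erase i) = jwSign i T := by
  unfold jwSign; congr 2; ext j; simp; grind

lemma jwSign_insert_self (i : ι) (T : Finset ι) : jwSign i (insert i T) = jwSign i T := by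
  unfold jwSign; congr 2; ext j; simp; grind

lemma jwSign_insert (i j : ι) (T : Finset ι) (hj : j ∉ T) :
    jwSign i (insert j T) = (if j < i then -1 else 1) * jwSign i T := by
  unfold jwSign
  rw [Finset.filter_insert]
  split_ifs with h
  · rw [Finset.card_insert_of_notMem (by simp [hj]), pow_succ]; ring
  · simp

lemma jwSign_erase (i j : ι) (T : Finset ι) (hj : j ∈ T) :
    jwSign i (T.erase j) = (if j < i then -1 else 1) * jwSign i T := by
  have h := jwSign_insert i j (T.erase j) (by simp)
  rw [Finset.insert_erase hj] at h
  rw [h]; split_ifs <;> simp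

lemma cre_mul_apply (i : ι) (M : Matrix (Finset ι) (Finset ι) ℂ) (S T : Finset ι) :
    (cre i * M) S T = if i ∈ S then jwSign i S * M (S.erase i) T else 0 := by
  rw [Matrix.mul_apply]
  split_ifs with h
  · rw [Finset.sum_eq_single (S.erase i)]
    · rw [← jwSign_erase_self]; simp [cre, jwSign, Finset.insert_erase h]
    · intro U _ hU
      have : ¬ (i ∉ U ∧ S = insert i U) := by
        rintro ⟨h1, rfl⟩; exact hU (by simp [h1])
      simp [cre, this]
    · simp
  · refine Finset.sum_eq_zero fun U _ => ?_
    have : ¬ (i ∉ U ∧ S = insert i U) := by rintro ⟨h1, rfl⟩; simp at h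
    simp [cre, this]

lemma creH_mul_apply (i : ι) (M : Matrix (Finset ι) (Finset ι) ℂ) (S T : Finset ι) :
    ((cre i)ᴴ * M) S T = if i ∈ S then 0 else jwSign i S * M (insert i S) T := by
  rw [Matrix.mul_apply]
  split_ifs with h
  · refine Finset.sum_eq_zero fun U _ => ?_
    simp [cre, h]
  · rw [Finset.sum_eq_single (insert i S)]
    · simp [cre, jwSign, h]
    · intro U _ hU
      simp [cre, hU]
    · simp

lemma cre_anticomm (i j : ι) : cre i * cre j + cre j * cre i = 0 := by
  ext S T
  have e1 := cre_mul_apply i (cre j * 1) S T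
  have e2 := cre_mul_apply j (cre i * 1) S T
  rw [mul_one] at e1 e2
  rw [Matrix.add_apply, e1, e2]
  conv_lhs => rw [← mul_one (cre i), ← mul_one (cre j), cre_mul_apply, cre_mul_apply]
  rcases eq_or_ne i j with rfl | hij
  · simp
  · by_cases hi : i ∈ S <;> by_cases hj : j ∈ S <;>
      simp only [hi, hj, Finset.mem_erase, hij, hij.symm, ne_eq, not_false_eq_true, and_self,
        if_true, if_false, mul_zero, add_zero, Matrix.zero_apply, and_false]
    rw [jwSign_erase j i S hi, jwSign_erase i j S hj, Finset.erase_right_comm]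
    rcases lt_or_gt_of_ne hij with h | h <;> simp [h, h.not_gt] <;> ring

lemma creH_cre_anticomm (i j : ι) :
    (cre i)ᴴ * cre j + cre j * (cre i)ᴴ = if i = j then 1 else 0 := by
  ext S T
  have e1 := creH_mul_apply i (cre j * 1) S T
  have e2 := cre_mul_apply j ((cre i)ᴴ * 1) S T
  rw [mul_one] at e1 e2
  rw [Matrix.add_apply, e1, e2]
  conv_lhs => rw [← mul_one (cre j), ← mul_one (cre i)ᴴ, cre_mul_apply, creH_mul_apply]
  rcases eq_or_ne i j with rfl | hij
  · by_cases hi : i ∈ S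
    · simp [hi, jwSign_erase_self, ← mul_assoc, jwSign_mul_self]
      rw [Finset.insert_erase hi]
    · simp [hi, jwSign_insert_self, ← mul_assoc, jwSign_mul_self]
      rw [Finset.erase_insert hi]
  · by_cases hi : i ∈ S <;> by_cases hj : j ∈ S <;>
      simp only [hi, hj, Finset.mem_erase, Finset.mem_insert, hij, hij.symm, ne_eq,
        not_false_eq_true, and_self, or_true, or_self, if_true, if_false, mul_zero, add_zero,
        Matrix.zero_apply, and_false]
    rw [jwSign_erase i j S hj, jwSign_insert j i S hi,
      Finset.erase_insert_of_ne (by exact hij)]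
    rcases lt_or_gt_of_ne hij with h | h <;> simp [h, h.not_gt] <;> ring

lemma creation_add (φ ψ : ι → ℂ) : creation (φ + ψ) = creation φ + creation ψ := by
  simp [creation, add_smul, Finset.sum_add_distrib]

lemma creation_smul (z : ℂ) (φ : ι → ℂ) : creation (z • φ) = z • creation φ := by
  simp [creation, Finset.smul_sum, mul_smul]

/-- The canonical anti-commutation relations. -/
theorem creation_anticomm (φ ψ : ι → ℂ) :
    creation φ * creation ψ + creation ψ * creation φ = 0 := by
  simp only [creation, Finset.sum_mul_sum]
  rw [Finset.sum_comm (f := fun i j => ψ i • cre i * φ j • cre j), ← Finset.sum_add_distrib]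
  refine Finset.sum_eq_zero fun i _ => ?_
  rw [← Finset.sum_add_distrib]
  refine Finset.sum_eq_zero fun j _ => ?_
  simp only [Matrix.smul_mul, Matrix.mul_smul]
  rw [smul_comm (ψ j), ← smul_add, ← smul_add, cre_anticomm]; simp

theorem annihilation_creation_anticomm (ψ φ : ι → ℂ) :
    annihilation ψ * creation φ + creation φ * annihilation ψ
      = (star ψ ⬝ᵥ φ) • (1 : Matrix (Finset ι) (Finset ι) ℂ) := by
  simp only [annihilation, creation, Matrix.conjTranspose_sum, Matrix.conjTranspose_smul,
    Finset.sum_mul_sum]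
  rw [Finset.sum_comm (f := fun i j => φ i • cre i * star (ψ j) • (cre j)ᴴ),
    ← Finset.sum_add_distrib]
  simp only [← Finset.sum_add_distrib, Matrix.smul_mul, Matrix.mul_smul]
  simp only [smul_comm (φ _) (star (ψ _)), ← smul_add, creH_cre_anticomm]
  simp [dotProduct, Finset.sum_smul, mul_smul]

/-- One factor of the density. -/
def qfFactor (t : ℝ) (e : ι → ℂ) : Matrix (Finset ι) (Finset ι) ℂ :=
  (t : ℂ) • (creation e * annihilation e) + (1 - (t : ℂ)) • (annihilation e * creation e)

lemma annihilation_anticomm (φ ψ : ι → ℂ) :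
    annihilation φ * annihilation ψ + annihilation ψ * annihilation φ = 0 := by
  have h := congrArg Matrix.conjTranspose (creation_anticomm ψ φ)
  simpa [annihilation, Matrix.conjTranspose_mul] using h

lemma creation_sq (φ : ι → ℂ) : creation φ * creation φ = 0 := by
  have h := creation_anticomm φ φ
  rwa [← two_smul ℂ, smul_eq_zero_iff_right (by norm_num)] at h

lemma qfFactor_creation_comm {t : ℝ} {e φ : ι → ℂ} (h : star e ⬝ᵥ φ = 0) :
    qfFactor t e * creation φ = creation φ * qfFactor t e := by
  have h1 : creation e * creation φ = - (creation φ * creation e) :=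
    eq_neg_of_add_eq_zero_left (creation_anticomm e φ)
  have h2 : annihilation e * creation φ = - (creation φ * annihilation e) := by
    have := annihilation_creation_anticomm e φ
    rw [h, zero_smul] at this
    exact eq_neg_of_add_eq_zero_left this
  have h3 : creation e * annihilation e * creation φ
      = creation φ * (creation e * annihilation e) := by
    rw [mul_assoc, h2, mul_neg, ← mul_assoc, h1, neg_mul, neg_neg, mul_assoc]
  have h4 : annihilation e * creation e * creation φ
      = creation φ * (annihilation e * creation e) := by
    rw [mul_assoc, h1, mul_neg, ← mul_assoc, h2, neg_mul, neg_neg, mul_assoc]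
  simp only [qfFactor, add_mul, mul_add, Matrix.smul_mul, Matrix.mul_smul, h3, h4]

lemma annihilation_creation_self {e : ι → ℂ} (h : star e ⬝ᵥ e = 1) :
    annihilation e * creation e = 1 - creation e * annihilation e := by
  have := annihilation_creation_anticomm e e
  rw [h, one_smul] at this
  exact eq_sub_of_add_eq this

lemma qfFactor_mul_creation_self {t : ℝ} {e : ι → ℂ} (h : star e ⬝ᵥ e = 1) :
    qfFactor t e * creation e = (t : ℂ) • creation e := by
  simp only [qfFactor, add_mul, Matrix.smul_mul]
  rw [mul_assoc (creation e), mul_assoc (annihilation e), creation_sq, mul_zero, smul_zero,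
    add_zero, annihilation_creation_self h, mul_sub, mul_one, ← mul_assoc, creation_sq, zero_mul,
    sub_zero]

lemma creation_self_mul_qfFactor {t : ℝ} {e : ι → ℂ} (h : star e ⬝ᵥ e = 1) :
    creation e * qfFactor t e = (1 - (t : ℂ)) • creation e := by
  simp only [qfFactor, mul_add, Matrix.mul_smul, ← mul_assoc, creation_sq, zero_mul, smul_zero,
    zero_add]
  rw [mul_assoc, annihilation_creation_self h, mul_sub, mul_one, ← mul_assoc, creation_sq,
    zero_mul, sub_zero]

lemma qfDensity_eq {Q : Matrix ι ι ℂ} (hQ : Q.IsHermitian) :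
    qfDensity Q = ((Finset.univ : Finset ι).sort.map fun j =>
      qfFactor (hQ.eigenvalues j) (hQ.eigenvectorBasis j)).prod := by
  rw [qfDensity, dif_pos hQ]; rfl

lemma star_dotProduct_eigenvectorBasis {Q : Matrix ι ι ℂ} (hQ : Q.IsHermitian) (i j : ι) :
    star (hQ.eigenvectorBasis i : ι → ℂ) ⬝ᵥ (hQ.eigenvectorBasis j : ι → ℂ)
      = if i = j then 1 else 0 := by
  have h := orthonormal_iff_ite.mp hQ.eigenvectorBasis.orthonormal i j
  rw [EuclideanSpace.inner_eq_star_dotProduct] at h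
  rw [dotProduct_comm]
  exact h

lemma list_prod_comm_creation (t : ι → ℝ) (e : ι → ι → ℂ) (φ : ι → ℂ) :
    ∀ l : List ι, (∀ j ∈ l, star (e j) ⬝ᵥ φ = 0) →
      (l.map fun j => qfFactor (t j) (e j)).prod * creation φ
        = creation φ * (l.map fun j => qfFactor (t j) (e j)).prod
  | [], _ => by simp
  | j :: l, h => by
    simp only [List.map_cons, List.prod_cons]
    rw [mul_assoc, list_prod_comm_creation t e φ l fun k hk => h k (by simp [hk]), ← mul_assoc,
      qfFactor_creation_comm (h j (by simp)), mul_assoc]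

lemma list_prod_creation (t : ι → ℝ) (e : ι → ι → ℂ)
    (he : ∀ i j, star (e i) ⬝ᵥ e j = if i = j then 1 else 0) (k : ι) :
    ∀ l : List ι, l.Nodup → k ∈ l →
      (1 - (t k : ℂ)) • ((l.map fun j => qfFactor (t j) (e j)).prod * creation (e k))
        = (t k : ℂ) • (creation (e k) * (l.map fun j => qfFactor (t j) (e j)).prod)
  | [], _, h => by simp at h
  | j :: l, hl, h => by
    simp only [List.map_cons, List.prod_cons]
    rw [List.nodup_cons] at hl
    by_cases hjk : j = k
    · subst hjk
      rw [mul_assoc, list_prod_comm_creation t e _ l fun i hi => ?_, ← mul_assoc, ← mul_assoc,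
        qfFactor_mul_creation_self (by simp [he]), creation_self_mul_qfFactor (by simp [he])]
      · simp only [Matrix.smul_mul, smul_smul, mul_comm]
      · rw [he, if_neg]; rintro rfl; exact hl.1 hi
    · have hk : k ∈ l := by simpa [Ne.symm hjk] using h
      rw [mul_assoc, ← Matrix.mul_smul, list_prod_creation t e he k l hl.2 hk, Matrix.mul_smul,
        ← mul_assoc, qfFactor_creation_comm (by rw [he, if_neg hjk]), mul_assoc]

/-- Intertwining relation between the density and the creation operators. -/
lemma qfDensity_creation {Q : Matrix ι ι ℂ} (hQ : Q.IsHermitian) (φ : ι → ℂ) :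
    qfDensity Q * creation φ
      = qfDensity Q * creation (Q *ᵥ φ) + creation (Q *ᵥ φ) * qfDensity Q := by
  have key : ∀ k, qfDensity Q * creation (hQ.eigenvectorBasis k)
      = qfDensity Q * creation (Q *ᵥ hQ.eigenvectorBasis k)
        + creation (Q *ᵥ hQ.eigenvectorBasis k) * qfDensity Q := by
    intro k
    have h := list_prod_creation hQ.eigenvalues (fun j => (hQ.eigenvectorBasis j : ι → ℂ))
      (star_dotProduct_eigenvectorBasis hQ) k Finset.univ.sort (Finset.sort_nodup _ _) (by simp)
    rw [← qfDensity_eq hQ, sub_smul, one_smul, sub_eq_iff_eq_add] at h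
    have hv : Q *ᵥ (hQ.eigenvectorBasis k : ι → ℂ)
        = (hQ.eigenvalues k : ℂ) • (hQ.eigenvectorBasis k : ι → ℂ) := by
      rw [hQ.mulVec_eigenvectorBasis k]; rfl
    rw [hv, creation_smul, Matrix.mul_smul, Matrix.smul_mul, add_comm, ← h]
  have hφ : φ = ∑ k, hQ.eigenvectorBasis.repr (WithLp.toLp 2 φ) k •
      (hQ.eigenvectorBasis k : ι → ℂ) := by
    have := congrArg (WithLp.ofLp) (hQ.eigenvectorBasis.sum_repr (WithLp.toLp 2 φ))
    simpa using this.symm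
  have hs : ∀ (s : Finset ι) (z : ι → ℂ) (v : ι → ι → ℂ),
      creation (∑ k ∈ s, z k • v k) = ∑ k ∈ s, z k • creation (v k) := by
    intro s z v
    induction s using Finset.induction_on with
    | empty => simp [creation]
    | insert a s ha ih => rw [Finset.sum_insert ha, Finset.sum_insert ha, creation_add, ih,
        creation_smul]
  rw [hφ]
  simp only [Matrix.mulVec_sum, Matrix.mulVec_smul, hs, Finset.mul_sum, Finset.sum_mul,
    Matrix.mul_smul, Matrix.smul_mul, ← Finset.sum_add_distrib, ← smul_add]
  exact Finset.sum_congr rfl fun k _ => by rw [← key k]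

/-- `a(φ₁)* ⋯ a(φ_n)*`. -/
def creationProd {n : ℕ} (φ : Fin n → ι → ℂ) : Matrix (Finset ι) (Finset ι) ℂ :=
  (List.ofFn fun i => creation (φ i)).prod

/-- `a(ψ_m) ⋯ a(ψ₁)`. -/
def annihilationProd {m : ℕ} (ψ : Fin m → ι → ℂ) : Matrix (Finset ι) (Finset ι) ℂ :=
  (List.ofFn fun i => annihilation (ψ i)).reverse.prod

lemma creationProd_succ {n : ℕ} (φ : Fin (n + 1) → ι → ℂ) :
    creationProd φ = creation (φ 0) * creationProd fun i => φ i.succ := by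
  simp [creationProd, List.ofFn_succ]

lemma annihilationProd_succ {n : ℕ} (φ : Fin (n + 1) → ι → ℂ) :
    annihilationProd φ = (annihilationProd fun i => φ i.succ) * annihilation (φ 0) := by
  simp [annihilationProd, List.ofFn_succ]

lemma creationProd_mul_creation (χ : ι → ℂ) : ∀ {n : ℕ} (φ : Fin n → ι → ℂ),
    creationProd φ * creation χ = (-1 : ℂ) ^ n • (creation χ * creationProd φ)
  | 0, φ => by simp [creationProd]
  | n + 1, φ => by
    rw [creationProd_succ, mul_assoc, creationProd_mul_creation χ, Matrix.mul_smul, ← mul_assoc,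
      ← mul_assoc, eq_neg_of_add_eq_zero_left (creation_anticomm (φ 0) χ), pow_succ]
    simp

lemma annihilationProd_mul_creation (χ : ι → ℂ) : ∀ {m : ℕ} (ψ : Fin (m + 1) → ι → ℂ),
    annihilationProd ψ * creation χ
      = (-1 : ℂ) ^ (m + 1) • (creation χ * annihilationProd ψ)
        + ∑ i : Fin (m + 1), ((-1 : ℂ) ^ (i : ℕ) * (star (ψ i) ⬝ᵥ χ)) •
            annihilationProd fun k => ψ (i.succAbove k)
  | 0, ψ => by
    have h := eq_sub_of_add_eq (annihilation_creation_anticomm (ψ 0) χ)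
    simp [annihilationProd, h]
    abel
  | m + 1, ψ => by
    have h := eq_sub_of_add_eq (annihilation_creation_anticomm (ψ 0) χ)
    rw [annihilationProd_succ, mul_assoc, h, mul_sub, ← mul_assoc,
      annihilationProd_mul_creation χ, Fin.sum_univ_succ (n := m + 1)]
    have e : ∀ i : Fin (m + 1), (annihilationProd fun k => ψ (i.succ.succAbove k))
        = (annihilationProd fun k => ψ (i.succAbove k).succ) * annihilation (ψ 0) := by
      intro i
      rw [annihilationProd_succ]
      simp
    simp only [e, add_mul, Finset.sum_mul, Matrix.smul_mul, Matrix.mul_smul, mul_one, mul_assoc]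
    simp only [Fin.val_zero, pow_zero, one_mul, Fin.succAbove_zero, Fin.val_succ, pow_succ _ (_ + 1),
      mul_neg, mul_one, neg_smul]
    simp only [pow_succ, mul_neg, mul_one, neg_mul, neg_smul, Finset.sum_neg_distrib, neg_neg]
    abel

/-- Matrices that raise the particle number by `k`. -/
def IsDeg (k : ℤ) (M : Matrix (Finset ι) (Finset ι) ℂ) : Prop :=
  ∀ S T, M S T ≠ 0 → (S.card : ℤ) = T.card + k

lemma IsDeg.mul {k l : ℤ} {M N : Matrix (Finset ι) (Finset ι) ℂ} (hM : IsDeg k M)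
    (hN : IsDeg l N) : IsDeg (k + l) (M * N) := by
  intro S T h
  rw [Matrix.mul_apply] at h
  obtain ⟨U, -, hU⟩ := Finset.exists_ne_zero_of_sum_ne_zero h
  have h1 := hM S U (left_ne_zero_of_mul hU)
  have h2 := hN U T (right_ne_zero_of_mul hU)
  omega

lemma IsDeg.add {k : ℤ} {M N : Matrix (Finset ι) (Finset ι) ℂ} (hM : IsDeg k M)
    (hN : IsDeg k N) : IsDeg k (M + N) := by
  intro S T h
  by_cases hM0 : M S T = 0
  · exact hN S T fun h0 => h (by simp [hM0, h0])
  · exact hM S T hM0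

lemma IsDeg.smul {k : ℤ} {M : Matrix (Finset ι) (Finset ι) ℂ} (hM : IsDeg k M) (z : ℂ) :
    IsDeg k (z • M) := fun S T h => hM S T fun h0 => h (by simp [h0])

lemma isDeg_one : IsDeg 0 (1 : Matrix (Finset ι) (Finset ι) ℂ) := by
  intro S T h
  by_cases hST : S = T
  · simp [hST]
  · exact absurd (Matrix.one_apply_ne hST) h

lemma isDeg_creation (φ : ι → ℂ) : IsDeg 1 (creation φ) := by
  intro S T h
  rw [creation, Matrix.sum_apply] at h
  obtain ⟨i, -, hi⟩ := Finset.exists_ne_zero_of_sum_ne_zero h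
  have h2 : cre i S T ≠ 0 := right_ne_zero_of_mul hi
  have h3 : i ∉ T ∧ S = insert i T := by
    by_contra hc; exact h2 (by simp only [cre, Matrix.of_apply, if_neg hc])
  rw [h3.2, Finset.card_insert_of_notMem h3.1]; simp

lemma isDeg_annihilation (φ : ι → ℂ) : IsDeg (-1) (annihilation φ) := by
  intro S T h
  have := isDeg_creation φ T S fun h0 => h (by simp [annihilation, h0])
  omega

lemma isDeg_list_prod : ∀ (k : ℤ) (l : List (Matrix (Finset ι) (Finset ι) ℂ)),
    (∀ M ∈ l, IsDeg k M) → IsDeg (l.length * k) l.prod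
  | k, [], _ => by simpa using isDeg_one
  | k, M :: l, h => by
    have := (h M (by simp)).mul (isDeg_list_prod k l fun N hN => h N (by simp [hN]))
    rw [List.prod_cons, List.length_cons]
    convert this using 1
    push_cast; ring

lemma trace_eq_zero_of_isDeg {k : ℤ} (hk : k ≠ 0) {M : Matrix (Finset ι) (Finset ι) ℂ}
    (hM : IsDeg k M) : M.trace = 0 := by
  refine Finset.sum_eq_zero fun S _ => ?_
  by_contra h
  exact hk (by simpa using hM S S h)

lemma isDeg_qfDensity {Q : Matrix ι ι ℂ} (hQ : Q.IsHermitian) : IsDeg 0 (qfDensity Q) := by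
  rw [qfDensity_eq hQ]
  have := isDeg_list_prod 0 ((Finset.univ : Finset ι).sort.map fun j =>
      qfFactor (hQ.eigenvalues j) (hQ.eigenvectorBasis j)) ?_
  · simpa using this
  · intro M hM
    obtain ⟨j, -, rfl⟩ := List.mem_map.mp hM
    refine IsDeg.add (IsDeg.smul ?_ _) (IsDeg.smul ?_ _)
    · simpa using (isDeg_creation _).mul (isDeg_annihilation (hQ.eigenvectorBasis j))
    · simpa using (isDeg_annihilation _).mul (isDeg_creation (hQ.eigenvectorBasis j))

lemma trace_qfFactor_mul {t : ℝ} {e : ι → ℂ} (h : star e ⬝ᵥ e = 1)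
    {Y : Matrix (Finset ι) (Finset ι) ℂ} (hY : Y * creation e = creation e * Y) :
    (qfFactor t e * Y).trace = Y.trace / 2 := by
  have h1 : (creation e * annihilation e * Y).trace = (annihilation e * creation e * Y).trace := by
    rw [Matrix.trace_mul_cycle, hY, Matrix.trace_mul_comm, ← mul_assoc]
  have h2 : (annihilation e * creation e * Y).trace
      = Y.trace - (creation e * annihilation e * Y).trace := by
    rw [annihilation_creation_self h, sub_mul, one_mul, Matrix.trace_sub]
  have h3 : (creation e * annihilation e * Y).trace = Y.trace / 2 := by
    linear_combination (1 / 2 : ℂ) * h1 + (1 / 2 : ℂ) * h2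
  simp only [qfFactor, add_mul, Matrix.smul_mul, Matrix.trace_add, Matrix.trace_smul, ← h1, h3,
    smul_eq_mul]
  ring

lemma trace_list_prod (t : ι → ℝ) (e : ι → ι → ℂ)
    (he : ∀ i j, star (e i) ⬝ᵥ e j = if i = j then 1 else 0) :
    ∀ l : List ι, l.Nodup → (l.map fun j => qfFactor (t j) (e j)).prod.trace
        = 2 ^ Fintype.card ι / 2 ^ l.length
  | [], _ => by simp [Matrix.trace_one]
  | j :: l, hl => by
    rw [List.nodup_cons] at hl
    rw [List.map_cons, List.prod_cons, trace_qfFactor_mul (by simp [he]), trace_list_prod t e he l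
      hl.2, List.length_cons, pow_succ]
    · ring
    · refine list_prod_comm_creation t e _ l fun i hi => ?_
      rw [he, if_neg]; rintro rfl; exact hl.1 hi

theorem trace_qfDensity {Q : Matrix ι ι ℂ} (hQ : Q.IsHermitian) : (qfDensity Q).trace = 1 := by
  rw [qfDensity_eq hQ, trace_list_prod hQ.eigenvalues (fun j => (hQ.eigenvectorBasis j : ι → ℂ))
    (star_dotProduct_eigenvectorBasis hQ) _ (Finset.sort_nodup _ _)]
  simp

/-- The quasi-free property, vanishing of the particle number changing expectations. -/
theorem qfDensity_wick_ne {Q : Matrix ι ι ℂ} (hQ : Q.IsHermitian) {n m : ℕ} (hnm : n ≠ m)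
    (φ : Fin n → ι → ℂ) (ψ : Fin m → ι → ℂ) :
    (qfDensity Q * (creationProd φ * annihilationProd ψ)).trace = 0 := by
  have h1 := isDeg_list_prod 1 (List.ofFn fun i => creation (φ i)) (by
    intro M hM; obtain ⟨i, rfl⟩ := (List.mem_ofFn' _ _).mp hM; exact isDeg_creation _)
  have h2 := isDeg_list_prod (-1) (List.ofFn fun i => annihilation (ψ i)).reverse (by
    intro M hM
    obtain ⟨i, rfl⟩ := (List.mem_ofFn' _ _).mp (List.mem_reverse.mp hM)
    exact isDeg_annihilation _)
  refine trace_eq_zero_of_isDeg ?_ ((isDeg_qfDensity hQ).mul (h1.mul h2))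
  simp only [List.length_ofFn, List.length_reverse]
  omega

/-- The quasi-free property: the expectation of `a(φ₁)* ⋯ a(φ_n)* a(ψ_n) ⋯ a(ψ₁)` is
`det ⟨ψ_i, Q φ_j⟩`. -/
theorem qfDensity_wick {Q : Matrix ι ι ℂ} (hQ : Q.IsHermitian) : ∀ {n : ℕ}
    (φ ψ : Fin n → ι → ℂ),
    (qfDensity Q * (creationProd φ * annihilationProd ψ)).trace
      = (Matrix.of fun i j => star (ψ i) ⬝ᵥ (Q *ᵥ φ j)).det
  | 0, φ, ψ => by simp [creationProd, annihilationProd, trace_qfDensity hQ]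
  | n + 1, φ, ψ => by
    set χ := Q *ᵥ φ 0 with hχ
    set C := creationProd fun i => φ i.succ with hC
    have h1 : (qfDensity Q * (creationProd φ * annihilationProd ψ)).trace
        = (qfDensity Q * (creation χ * (C * annihilationProd ψ)
          + C * annihilationProd ψ * creation χ)).trace := by
      rw [creationProd_succ, mul_assoc (creation (φ 0)), ← mul_assoc, qfDensity_creation hQ, add_mul,
        Matrix.trace_add, mul_add, Matrix.trace_add, mul_assoc, mul_assoc,
        Matrix.trace_mul_comm (creation χ)]
      simp only [mul_assoc]
      rfl
    have h2 : creation χ * (C * annihilationProd ψ) + C * annihilationProd ψ * creation χ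
        = ∑ i : Fin (n + 1), ((-1 : ℂ) ^ (i : ℕ) * (star (ψ i) ⬝ᵥ χ)) •
            (C * annihilationProd fun k => ψ (i.succAbove k)) := by
      rw [mul_assoc C, annihilationProd_mul_creation, mul_add, Matrix.mul_smul, ← mul_assoc C,
        hC, creationProd_mul_creation, Matrix.smul_mul, smul_smul, ← pow_add, Finset.mul_sum]
      simp only [Matrix.mul_smul, mul_assoc]
      rw [show (-1 : ℂ) ^ (n + 1 + n) = -1 from Odd.neg_one_pow ⟨n, by ring⟩]
      simp
    rw [h1, h2, Finset.mul_sum, Matrix.trace_sum, Matrix.det_succ_column_zero]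
    refine Finset.sum_congr rfl fun i _ => ?_
    rw [Matrix.mul_smul, Matrix.trace_smul, hC, qfDensity_wick hQ]
    rfl

lemma posSemidef_list_prod (t : ι → ℝ) (ht : ∀ i, 0 ≤ t i ∧ t i ≤ 1) (e : ι → ι → ℂ)
    (he : ∀ i j, star (e i) ⬝ᵥ e j = if i = j then 1 else 0) :
    ∀ l : List ι, l.Nodup → (l.map fun j => qfFactor (t j) (e j)).prod.PosSemidef
  | [], _ => by simpa using Matrix.PosSemidef.one
  | j :: l, hl => by
    rw [List.nodup_cons] at hl
    rw [List.map_cons, List.prod_cons]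
    have hp := posSemidef_list_prod t ht e he l hl.2
    have hc := list_prod_comm_creation t e (e j) l fun i hi => by
      rw [he, if_neg]; rintro rfl; exact hl.1 hi
    set Y := (l.map fun j => qfFactor (t j) (e j)).prod
    have ha : annihilation (e j) * Y = Y * annihilation (e j) := by
      have := congrArg Matrix.conjTranspose hc
      simpa [Matrix.conjTranspose_mul, hp.isHermitian.eq, annihilation] using this
    have h1 : creation (e j) * annihilation (e j) * Y
        = creation (e j) * Y * (creation (e j))ᴴ := by
      rw [mul_assoc, ha, ← mul_assoc]; rfl
    have h2 : annihilation (e j) * creation (e j) * Y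
        = annihilation (e j) * Y * (annihilation (e j))ᴴ := by
      rw [mul_assoc, ← hc, ← mul_assoc, annihilation, Matrix.conjTranspose_conjTranspose]
    rw [qfFactor, add_mul, Matrix.smul_mul, Matrix.smul_mul, h1, h2]
    refine ((hp.mul_mul_conjTranspose_same _).smul ?_).add
      ((hp.mul_mul_conjTranspose_same _).smul ?_)
    · exact_mod_cast (ht j).1
    · have := sub_nonneg.mpr (ht j).2
      exact_mod_cast this

/-- The density is positive semi-definite if `0 ≤ Q ≤ I`. -/
theorem posSemidef_qfDensity {Q : Matrix ι ι ℂ} (h0 : Q.PosSemidef) (h1 : (1 - Q).PosSemidef) :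
    (qfDensity Q).PosSemidef := by
  have hQ := h0.isHermitian
  rw [qfDensity_eq hQ]
  refine posSemidef_list_prod hQ.eigenvalues (fun i => ⟨h0.eigenvalues_nonneg i, ?_⟩)
    (fun j => (hQ.eigenvectorBasis j : ι → ℂ)) (star_dotProduct_eigenvectorBasis hQ) _
    (Finset.sort_nodup _ _)
  set v : ι → ℂ := (hQ.eigenvectorBasis i).ofLp with hv
  have hvv : star v ⬝ᵥ v = 1 := by simpa using star_dotProduct_eigenvectorBasis hQ i i
  have hQv : Q *ᵥ v = (hQ.eigenvalues i : ℂ) • v := by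
    rw [hv, hQ.mulVec_eigenvectorBasis i]; rfl
  have h := h1.dotProduct_mulVec_nonneg v
  rw [Matrix.sub_mulVec, Matrix.one_mulVec, hQv, dotProduct_sub, dotProduct_smul, hvv] at h
  have h2 : (0 : ℂ) ≤ ((1 - hQ.eigenvalues i : ℝ) : ℂ) := by simpa using h
  have h3 : (0 : ℝ) ≤ 1 - hQ.eigenvalues i := by exact_mod_cast h2
  linarith

end FockLemmas

/-! ### The chain -/

instance fact_two_pi_pos : Fact (0 < 2 * Real.pi) := ⟨Real.two_pi_pos⟩

/-- The torus `ℝ / 2πℤ`. -/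
abbrev Torus : Type := AddCircle (2 * Real.pi)

/-- The one-particle space `ℓ²_d(ℤ) = ⨁_{i < d} ℓ²(ℤ)` of the chain with `d` modes per site. -/
abbrev ChainSpace (d : ℕ) : Type := PiLp 2 fun _ : Fin d => lp (fun _ : ℤ => ℂ) 2

/-- The basis vector `1_{k} ⊗ 1_{i}` (mode `i` at site `k`). -/
def siteVec {d : ℕ} (k : ℤ) (i : Fin d) : ChainSpace d :=
  WithLp.toLp 2 (Pi.single i (lp.single 2 k (1 : ℂ)))

/-- The inverse Fourier series `ℓ²(ℤ) → L²(𝕋)`, `1_{k} ↦ e^{ikx}`, with respect to normalized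
Lebesgue measure on the torus. -/
def fourierL2 (f : lp (fun _ : ℤ => ℂ) 2) :
    Lp ℂ 2 (AddCircle.haarAddCircle (T := 2 * Real.pi)) :=
  (fourierBasis (T := 2 * Real.pi)).repr.symm f

/-- `Q` is the translation-invariant (block Toeplitz) operator with symbol function `q`, i.e. it
becomes the multiplication by the matrix function `q` under Fourier transform: `F Q = M_q F`. -/
def HasSymbol {d : ℕ} (Q : ChainSpace d →L[ℂ] ChainSpace d)
    (q : Torus → Matrix (Fin d) (Fin d) ℂ) : Prop :=
  ∀ (f : ChainSpace d) (i : Fin d),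
    (fourierL2 (Q f i) : Torus → ℂ) =ᵐ[AddCircle.haarAddCircle]
      fun x => ∑ j, q x i j * (fourierL2 (f j) : Torus → ℂ) x

/-- The cut-off `Q_n` of `Q` to the sites `0, …, n-1`, as a matrix in the basis
`1_{k} ⊗ 1_{i}`, `k < n`, `i < d`, ordered lexicographically. -/
def cutoff {d : ℕ} (Q : ChainSpace d →L[ℂ] ChainSpace d) (n : ℕ) :
    Matrix (Fin n ×ₗ Fin d) (Fin n ×ₗ Fin d) ℂ :=
  Matrix.of fun a b =>
    inner ℂ (siteVec ((ofLex a).1 : ℤ) (ofLex a).2) (Q (siteVec ((ofLex b).1 : ℤ) (ofLex b).2))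

/-- The regularization `lim_n (1/n) Δ(ω̂_{Q_n} ‖ ω̂_{R_n})` exists and equals `ℓ`. The quantity
`Δ` is given for matrices over every finite index type. -/
def HasRegularization {d : ℕ}
    (Δ : ∀ {κ : Type} [Fintype κ] [DecidableEq κ], Matrix κ κ ℂ → Matrix κ κ ℂ → ℝ)
    (Q R : ChainSpace d →L[ℂ] ChainSpace d) (ℓ : ℝ) : Prop :=
  Tendsto (fun n : ℕ => 1 / (n : ℝ) * Δ (qfDensity (cutoff Q n)) (qfDensity (cutoff R n)))
    atTop (𝓝 ℓ)

/-- The average `(1/2π) ∫_0^{2π} f(x) dx`. -/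
def torusAverage (f : Torus → ℝ) : ℝ :=
  1 / (2 * Real.pi) * ∫ x in (0 : ℝ)..(2 * Real.pi), f (x : Torus)

end

end FermiChain

open FermiChain

/-!
The proof has an algebraic and an analytic half.

**Reduction to one-particle operators.** Let `dΓ(X) = ∑ X_{ij} a(e_i)* a(e_j)`. The Gaussian
operator `G = exp (l + dΓ(X))` satisfies `G a(φ)* = a(e^X φ)* G` and multiplies the vacuum by `e^l`;
since the operators `a(φ)*` generate the Fock space from the vacuum, these two relations determine
`G` (`ext_of_exchange`). Hence second quantization respects products
(`gaussian_mul_mul`), and a quasi-free density with symbol `S` is the Gaussian operator with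
`l = Tr log (I - S)`, `X = log W_S` (`qfDensity_eq_gaussian`). Powers and logarithms of Gaussian
operators are immediate, so every Rényi operator of two quasi-free densities is the second
quantization of the same Rényi operator of the weights `W_S`, `W_T` (`renyiOp_gaussian`).
Normalization of the densities gives the partition function `Tr G = e^l det (I + e^X)`, whence
`psi_qfDensity`; the case `α = 1` uses `Tr ω_S dΓ(X) = Tr S X`, an instance of Wick's formula.

**The limit theorem.** The plane waves `e^{ikx} e_i`, `k < n`, embed `ℂ^n ⊗ ℂ^d` isometrically in
`L²(𝕋; ℂ^d)`. A bounded sequence of matrices has asymptotic symbol `a` if this embedding intertwines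
it with multiplication by `a` up to an error of squared Hilbert–Schmidt norm `o(n)`
(`HasAsympSymbol`). Because the error obeys a Leibniz rule, such sequences are closed under sums and
products and, by polynomial approximation, under continuous functional calculus; their normalized
traces converge to the average trace of the symbol (`HasAsympSymbol.tendsto_rtr`). The cut-offs
of a translation-invariant operator have its symbol as asymptotic symbol, because the error is
the mean of the `L²` truncation errors of a Fourier series over windows `[-l, n-l)`, almost all of
which contain any given finite set of frequencies (`hasAsympSymbol_cutoff`). The bounds
`c ≤ q, r ≤ 1 - c` pass to the cut-offs, so all functions involved are continuous on the spectra,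
and the trace formulas of the first half have the claimed limits.
-/

namespace FermiChain

noncomputable section

/-! ### Real traces -/

section Trace

variable {ι : Type*} [Fintype ι]

lemma rtr_add (A B : Matrix ι ι ℂ) : rtr (A + B) = rtr A + rtr B := by simp [rtr]
lemma rtr_sub (A B : Matrix ι ι ℂ) : rtr (A - B) = rtr A - rtr B := by simp [rtr]
lemma rtr_smul (r : ℝ) (A : Matrix ι ι ℂ) : rtr (r • A) = r * rtr A := by
  simp [rtr, Matrix.trace_smul]

end Trace

/-! ### Functional calculus of Hermitian matrices -/

section MatrixCalculus

variable {ι : Type*} [Fintype ι] [DecidableEq ι]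

/-- The spectrum of a matrix is finite, so every function is continuous on it. -/
lemma continuousOn_spectrum (f : ℝ → ℝ) (A : Matrix ι ι ℂ) : ContinuousOn f (spectrum ℝ A) :=
  (Matrix.finite_real_spectrum (A := A)).continuousOn f

lemma cfc_cfc (g f : ℝ → ℝ) {A : Matrix ι ι ℂ} (hA : A.IsHermitian) :
    cfc g (cfc f A) = cfc (fun t => g (f t)) A :=
  (cfc_comp' g f A (((Matrix.finite_real_spectrum (A := A)).image f).continuousOn g)
    (continuousOn_spectrum f A) hA.isSelfAdjoint).symm

lemma isHermitian_cfc (f : ℝ → ℝ) (A : Matrix ι ι ℂ) : (cfc f A).IsHermitian :=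
  (cfc_predicate (p := IsSelfAdjoint) f A).isHermitian

lemma spectrum_cfc (f : ℝ → ℝ) {A : Matrix ι ι ℂ} (hA : A.IsHermitian) :
    spectrum ℝ (cfc f A) = f '' spectrum ℝ A :=
  cfc_map_spectrum f A hA.isSelfAdjoint (continuousOn_spectrum f A)

lemma cfc_add_fun (f g : ℝ → ℝ) (A : Matrix ι ι ℂ) :
    cfc (fun t => f t + g t) A = cfc f A + cfc g A :=
  cfc_add A f g (continuousOn_spectrum f A) (continuousOn_spectrum g A)

lemma cfc_sub_fun (f g : ℝ → ℝ) (A : Matrix ι ι ℂ) :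
    cfc (fun t => f t - g t) A = cfc f A - cfc g A :=
  cfc_sub f g A (continuousOn_spectrum f A) (continuousOn_spectrum g A)

lemma cfc_mul_fun (f g : ℝ → ℝ) (A : Matrix ι ι ℂ) :
    cfc (fun t => f t * g t) A = cfc f A * cfc g A :=
  cfc_mul f g A (continuousOn_spectrum f A) (continuousOn_spectrum g A)

lemma cfc_smul_fun (r : ℝ) (f : ℝ → ℝ) (A : Matrix ι ι ℂ) :
    cfc (fun t => r * f t) A = r • cfc f A :=
  cfc_const_mul r f A (continuousOn_spectrum f A)

lemma cfc_id_fun {A : Matrix ι ι ℂ} (hA : A.IsHermitian) : cfc (fun t : ℝ => t) A = A :=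
  cfc_id' ℝ A hA.isSelfAdjoint

lemma cfc_one_fun {A : Matrix ι ι ℂ} (hA : A.IsHermitian) : cfc (fun _ : ℝ => (1 : ℝ)) A = 1 :=
  cfc_const_one ℝ A hA.isSelfAdjoint

lemma cfc_comp_smul_fun (r : ℝ) (f : ℝ → ℝ) {A : Matrix ι ι ℂ} (hA : A.IsHermitian) :
    cfc f (r • A) = cfc (fun t => f (r * t)) A := by
  rw [← cfc_cfc f (fun t => r * t) hA, cfc_smul_fun, cfc_id_fun hA]

lemma one_sub_eq_cfc {A : Matrix ι ι ℂ} (hA : A.IsHermitian) :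
    1 - A = cfc (fun t : ℝ => 1 - t) A := by
  rw [cfc_sub_fun (fun _ => 1) (fun t => t), cfc_one_fun hA, cfc_id_fun hA]

lemma one_add_eq_cfc {A : Matrix ι ι ℂ} (hA : A.IsHermitian) :
    1 + A = cfc (fun t : ℝ => 1 + t) A := by
  rw [cfc_add_fun (fun _ => 1) (fun t => t), cfc_one_fun hA, cfc_id_fun hA]

lemma cfc_nonsing_inv (f : ℝ → ℝ) {A : Matrix ι ι ℂ} (hA : A.IsHermitian)
    (hf : ∀ t ∈ spectrum ℝ A, f t ≠ 0) : (cfc f A)⁻¹ = cfc (fun t => (f t)⁻¹) A := by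
  refine Matrix.inv_eq_right_inv ?_
  rw [← cfc_mul_fun, ← cfc_one_fun hA]
  exact cfc_congr fun t ht => mul_inv_cancel₀ (hf t ht)

/-- The functional calculus acts on eigenvectors by evaluation at the eigenvalue. -/
lemma cfc_mulVec_of_mulVec_eq_smul (f : ℝ → ℝ) {A : Matrix ι ι ℂ} (hA : A.IsHermitian)
    {v : ι → ℂ} {t : ℝ} (hv : A *ᵥ v = (t : ℂ) • v) : cfc f A *ᵥ v = (f t : ℂ) • v := by
  set U : Matrix ι ι ℂ := (hA.eigenvectorUnitary : Matrix ι ι ℂ) with hU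
  have hUU : star U * U = 1 := by rw [hU]; simp
  have hUU' : U * star U = 1 := by rw [hU]; simp
  have hc : ∀ g : ℝ → ℝ, cfc g A
      = U * Matrix.diagonal (fun i => (g (hA.eigenvalues i) : ℂ)) * star U := fun g => by
    rw [hA.cfc_eq, Matrix.IsHermitian.cfc, Unitary.conjStarAlgAut_apply]; rfl
  set w := star U *ᵥ v with hw
  have hvw : v = U *ᵥ w := by rw [hw, Matrix.mulVec_mulVec, hUU', Matrix.one_mulVec]
  have h1 : ∀ i, (hA.eigenvalues i : ℂ) * w i = t * w i := by
    have h2 := hc (fun t => t)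
    rw [cfc_id_fun hA] at h2
    have h3 : star U *ᵥ (A *ᵥ v) = (t : ℂ) • w := by rw [hv, Matrix.mulVec_smul]
    rw [h2, Matrix.mulVec_mulVec, ← mul_assoc, ← mul_assoc, hUU, one_mul, ← Matrix.mulVec_mulVec,
      ← hw] at h3
    intro i
    simpa [Matrix.mulVec_diagonal] using congrFun h3 i
  rw [hc, ← Matrix.mulVec_mulVec, ← hw, ← Matrix.mulVec_mulVec]
  conv_rhs => rw [hvw, ← Matrix.mulVec_smul]
  congr 1
  ext i
  rw [Matrix.mulVec_diagonal, Pi.smul_apply, smul_eq_mul]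
  by_cases hi : w i = 0
  · simp [hi]
  · have := mul_right_cancel₀ hi (h1 i)
    rw [Complex.ofReal_inj.mp this]

/-- Linear maps that agree on the eigenvectors of a Hermitian matrix agree. -/
lemma linearMap_ext_eigenvectorBasis {A : Matrix ι ι ℂ} (hA : A.IsHermitian) {V : Type*}
    [AddCommGroup V] [Module ℂ V] {f g : (ι → ℂ) →ₗ[ℂ] V}
    (h : ∀ k, f (hA.eigenvectorBasis k) = g (hA.eigenvectorBasis k)) : f = g := by
  have h1 : f ∘ₗ (WithLp.linearEquiv 2 ℂ (ι → ℂ)).toLinearMap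
      = g ∘ₗ (WithLp.linearEquiv 2 ℂ (ι → ℂ)).toLinearMap :=
    hA.eigenvectorBasis.toBasis.ext fun k => by simpa using h k
  exact LinearMap.ext fun φ => LinearMap.congr_fun h1 (WithLp.toLp 2 φ)

/-! ### Exponentials and logarithms -/

lemma isHermitian_mexp (A : Matrix ι ι ℂ) : (mexp A).IsHermitian := isHermitian_cfc _ A
lemma isHermitian_mlog (A : Matrix ι ι ℂ) : (mlog A).IsHermitian := isHermitian_cfc _ A
lemma mlog_mexp {A : Matrix ι ι ℂ} (hA : A.IsHermitian) : mlog (mexp A) = A := by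
  rw [mlog, mexp, cfc_cfc _ _ hA]
  simp only [Real.log_exp]
  exact cfc_id_fun hA

lemma mexp_mlog {A : Matrix ι ι ℂ} (hA : A.IsHermitian) (h : ∀ t ∈ spectrum ℝ A, 0 < t) :
    mexp (mlog A) = A := by
  rw [mlog, mexp, cfc_cfc _ _ hA]
  conv_rhs => rw [← cfc_id_fun hA]
  exact cfc_congr fun t ht => Real.exp_log (h t ht)

lemma mpow_mexp {A : Matrix ι ι ℂ} (hA : A.IsHermitian) (p : ℝ) :
    mpow (mexp A) p = mexp (p • A) := by
  rw [mpow, mexp, mexp, cfc_cfc _ _ hA, cfc_comp_smul_fun _ _ hA]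
  simp only [← Real.exp_mul, mul_comm p]

lemma mexp_nonsing_inv {A : Matrix ι ι ℂ} (hA : A.IsHermitian) :
    (mexp A)⁻¹ = mexp ((-1 : ℝ) • A) := by
  rw [mexp, cfc_nonsing_inv _ hA (fun t _ => (Real.exp_pos t).ne'), mexp,
    cfc_comp_smul_fun _ _ hA]
  simp only [← Real.exp_neg, neg_one_mul]

lemma mexp_add_smul_one {A : Matrix ι ι ℂ} (hA : A.IsHermitian) (r : ℝ) :
    mexp (A + r • (1 : Matrix ι ι ℂ)) = Real.exp r • mexp A := by
  have h : A + r • (1 : Matrix ι ι ℂ) = cfc (fun t : ℝ => t + r * 1) A := by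
    rw [cfc_add_fun (fun t => t) (fun _ => r * 1), cfc_smul_fun r (fun _ => 1), cfc_one_fun hA,
      cfc_id_fun hA]
  rw [h, mexp, cfc_cfc _ _ hA, mexp, ← cfc_smul_fun]
  simp only [mul_one, Real.exp_add, mul_comm]

lemma pos_of_mem_spectrum_of_posDef {A : Matrix ι ι ℂ} (hA : A.PosDef) :
    ∀ t ∈ spectrum ℝ A, 0 < t := by
  intro t ht
  rw [hA.1.spectrum_real_eq_range_eigenvalues] at ht
  obtain ⟨i, rfl⟩ := ht
  exact hA.eigenvalues_pos i

lemma posDef_of_spectrum_pos {A : Matrix ι ι ℂ} (hA : A.IsHermitian)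
    (h : ∀ t ∈ spectrum ℝ A, 0 < t) : A.PosDef :=
  hA.posDef_iff_eigenvalues_pos.mpr fun i => h _ (hA.eigenvalues_mem_spectrum_real i)

lemma posDef_mexp {A : Matrix ι ι ℂ} (hA : A.IsHermitian) : (mexp A).PosDef := by
  refine posDef_of_spectrum_pos (isHermitian_mexp A) ?_
  rw [mexp, spectrum_cfc _ hA]
  rintro _ ⟨t, -, rfl⟩
  exact Real.exp_pos t

lemma posDef_mexp_mul_mul {A B : Matrix ι ι ℂ} (hA : A.IsHermitian) (hB : B.IsHermitian) :
    (mexp A * mexp B * mexp A).PosDef := by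
  have h := (posDef_mexp hB).mul_mul_conjTranspose_same (B := mexp A)
    (Matrix.vecMul_injective_of_isUnit (posDef_mexp hA).isUnit)
  rwa [(isHermitian_mexp A).eq] at h

lemma rtr_cfc (f : ℝ → ℝ) {A : Matrix ι ι ℂ} (hA : A.IsHermitian) :
    rtr (cfc f A) = ∑ i, f (hA.eigenvalues i) := by
  rw [hA.cfc_eq, Matrix.IsHermitian.cfc, Unitary.conjStarAlgAut_apply, rtr,
    Matrix.trace_mul_cycle]
  simp [Matrix.trace, Matrix.diagonal]

section Norm
open scoped Matrix.Norms.L2Operator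

lemma mexp_eq_exp {A : Matrix ι ι ℂ} (hA : A.IsHermitian) : mexp A = NormedSpace.exp A :=
  CFC.real_exp_eq_normedSpace_exp hA.isSelfAdjoint

lemma mul_mexp_eq {A B C : Matrix ι ι ℂ} (hA : A.IsHermitian) (hB : B.IsHermitian)
    (h : C * A = B * C) : C * mexp A = mexp B * C := by
  rw [mexp_eq_exp hA, mexp_eq_exp hB]
  let : NormedAlgebra ℚ (Matrix ι ι ℂ) := NormedAlgebra.restrictScalars ℚ ℂ _
  exact SemiconjBy.exp_right h

end Norm

end MatrixCalculus

/-! ### Second quantization -/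

section SecondQuantization

variable {ι : Type*} [Fintype ι] [LinearOrder ι]

/-- The second quantization `dΓ(X) = ∑ X_{ij} a(e_i)* a(e_j)` of a one-particle operator. -/
def secondQuant (X : Matrix ι ι ℂ) : Matrix (Finset ι) (Finset ι) ℂ :=
  ∑ i, ∑ j, X i j • (cre i * (cre j)ᴴ)

/-- The quadratic Hamiltonian `l + dΓ(X)`. -/
def quadHam (l : ℝ) (X : Matrix ι ι ℂ) : Matrix (Finset ι) (Finset ι) ℂ :=
  l • (1 : Matrix (Finset ι) (Finset ι) ℂ) + secondQuant X

/-- The Gaussian operator `exp (l + dΓ(X))`. -/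
def gaussian (l : ℝ) (X : Matrix ι ι ℂ) : Matrix (Finset ι) (Finset ι) ℂ :=
  mexp (quadHam l X)

/-- The vacuum vector `e_∅` of the Fock space. -/
def vacuum : Finset ι → ℂ := Pi.single ∅ 1

lemma mulVec_vacuum (M : Matrix (Finset ι) (Finset ι) ℂ) (S : Finset ι) :
    (M *ᵥ vacuum) S = M S ∅ := by
  rw [vacuum, Matrix.mulVec_single_one]; rfl

lemma secondQuant_add (X Y : Matrix ι ι ℂ) :
    secondQuant (X + Y) = secondQuant X + secondQuant Y := by
  simp [secondQuant, add_smul, Finset.sum_add_distrib]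

lemma secondQuant_smul (r : ℝ) (X : Matrix ι ι ℂ) :
    secondQuant (r • X) = r • secondQuant X := by
  simp only [secondQuant, Finset.smul_sum]
  refine Finset.sum_congr rfl fun i _ => Finset.sum_congr rfl fun j _ => ?_
  rw [← smul_assoc]; rfl

lemma quadHam_smul (r l : ℝ) (X : Matrix ι ι ℂ) :
    r • quadHam l X = quadHam (r * l) (r • X) := by
  simp [quadHam, secondQuant_smul, smul_smul]

lemma quadHam_add (l m : ℝ) (X Y : Matrix ι ι ℂ) :
    quadHam l X + quadHam m Y = quadHam (l + m) (X + Y) := by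
  simp only [quadHam, secondQuant_add, add_smul]; abel

lemma isHermitian_quadHam (l : ℝ) {X : Matrix ι ι ℂ} (hX : X.IsHermitian) :
    (quadHam l X).IsHermitian := by
  have h1 : (secondQuant X)ᴴ = secondQuant X := by
    simp only [secondQuant, Matrix.conjTranspose_sum, Matrix.conjTranspose_smul,
      Matrix.conjTranspose_mul, Matrix.conjTranspose_conjTranspose]
    rw [Finset.sum_comm]
    refine Finset.sum_congr rfl fun i _ => Finset.sum_congr rfl fun j _ => ?_
    rw [hX.apply]
  rw [Matrix.IsHermitian, quadHam, Matrix.conjTranspose_add, h1]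
  simp [Matrix.conjTranspose_smul]

lemma creH_mul_creation (j : ι) (φ : ι → ℂ) :
    (cre j)ᴴ * creation φ = φ j • 1 - creation φ * (cre j)ᴴ := by
  have h : annihilation (Pi.single j 1 : ι → ℂ) = (cre j)ᴴ := by
    simp [annihilation, creation, Pi.single_apply, ite_smul]
  have := annihilation_creation_anticomm (Pi.single j 1) φ
  rw [h] at this
  rw [eq_sub_iff_add_eq, this]
  simp [dotProduct, Pi.single_apply, apply_ite (star : ℂ → ℂ)]

lemma cre_mul_creation (i : ι) (φ : ι → ℂ) : cre i * creation φ = - (creation φ * cre i) := by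
  have h : creation (Pi.single i 1 : ι → ℂ) = cre i := by
    simp [creation, Pi.single_apply, ite_smul]
  rw [← h]
  exact eq_neg_of_add_eq_zero_left (creation_anticomm _ _)

/-- The commutation relation `[dΓ(X), a(φ)*] = a(Xφ)*`. -/
lemma secondQuant_mul_creation (X : Matrix ι ι ℂ) (φ : ι → ℂ) :
    secondQuant X * creation φ = creation φ * secondQuant X + creation (X *ᵥ φ) := by
  have h : ∀ i j, cre i * (cre j)ᴴ * creation φ
      = φ j • cre i + creation φ * (cre i * (cre j)ᴴ) := fun i j => by
    rw [mul_assoc, creH_mul_creation, mul_sub, Matrix.mul_smul, mul_one, ← mul_assoc,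
      cre_mul_creation, neg_mul, sub_neg_eq_add, mul_assoc]
  simp only [secondQuant, Finset.sum_mul, Matrix.smul_mul, h, smul_add, Finset.sum_add_distrib,
    Finset.mul_sum, Matrix.mul_smul]
  rw [add_comm]
  congr 1
  simp [creation, Matrix.mulVec, dotProduct, Finset.sum_smul, smul_smul]

lemma quadHam_mulVec_vacuum (l : ℝ) (X : Matrix ι ι ℂ) :
    quadHam l X *ᵥ vacuum = (l : ℂ) • vacuum := by
  have h : secondQuant X *ᵥ vacuum = 0 := by
    ext S
    rw [mulVec_vacuum, secondQuant, Matrix.sum_apply]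
    refine Finset.sum_eq_zero fun i _ => ?_
    rw [Matrix.sum_apply]
    refine Finset.sum_eq_zero fun j _ => ?_
    have : (cre i * (cre j)ᴴ) S ∅ = 0 := by
      rw [Matrix.mul_apply]
      refine Finset.sum_eq_zero fun U _ => ?_
      have : (cre j) ∅ U = 0 := by simp [cre, (Finset.insert_ne_empty j U).symm]
      simp [this]
    simp [this]
  rw [quadHam, Matrix.add_mulVec, h, Matrix.smul_mulVec, Matrix.one_mulVec, add_zero]
  rfl

/-- The operators `a(φ)*` generate the Fock space from the vacuum, so an operator is determined by
its action on the vacuum and its exchange relations with the `a(φ)*`. -/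
lemma ext_of_exchange {M N : Matrix (Finset ι) (Finset ι) ℂ} (A : (ι → ℂ) → (ι → ℂ))
    (hM : ∀ φ, M * creation φ = creation (A φ) * M)
    (hN : ∀ φ, N * creation φ = creation (A φ) * N)
    (h : M *ᵥ vacuum = N *ᵥ vacuum) : M = N := by
  have key : ∀ L : Matrix (Finset ι) (Finset ι) ℂ,
      (∀ φ, L * creation φ = creation (A φ) * L) → ∀ (i : ι) (T : Finset ι), i ∉ T → ∀ S,
      L S (insert i T) = jwSign i T * ∑ U, creation (A (Pi.single i 1)) S U * L U T := by
    intro L hL i T hi S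
    have h1 : creation (Pi.single i 1 : ι → ℂ) = cre i := by
      simp [creation, Pi.single_apply, ite_smul]
    have h2 : (L * cre i) S T = L S (insert i T) * jwSign i T := by
      rw [Matrix.mul_apply, Finset.sum_eq_single (insert i T)]
      · simp [cre, jwSign, hi]
      · intro U _ hU; simp [cre, hU]
      · simp
    rw [← Matrix.mul_apply, ← hL, h1, h2, mul_comm, mul_assoc, jwSign_mul_self, mul_one]
  ext S T
  induction T using Finset.induction_on generalizing S with
  | empty => rw [← mulVec_vacuum M, ← mulVec_vacuum N, h]
  | insert i T hi ih => rw [key M hM i T hi S, key N hN i T hi S]; simp only [ih]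

lemma gaussian_mulVec_vacuum (l : ℝ) {X : Matrix ι ι ℂ} (hX : X.IsHermitian) :
    gaussian l X *ᵥ vacuum = (Real.exp l : ℂ) • vacuum :=
  cfc_mulVec_of_mulVec_eq_smul _ (isHermitian_quadHam l hX) (quadHam_mulVec_vacuum l X)

/-- `creation` as a linear map. -/
def creationL : (ι → ℂ) →ₗ[ℂ] Matrix (Finset ι) (Finset ι) ℂ where
  toFun := creation
  map_add' := creation_add
  map_smul' := creation_smul

/-- The exchange relation `exp (l + dΓ(X)) a(φ)* = a(e^X φ)* exp (l + dΓ(X))`. -/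
lemma gaussian_mul_creation (l : ℝ) {X : Matrix ι ι ℂ} (hX : X.IsHermitian) (φ : ι → ℂ) :
    gaussian l X * creation φ = creation (mexp X *ᵥ φ) * gaussian l X := by
  have hK := isHermitian_quadHam l hX
  have h : LinearMap.mulLeft ℂ (gaussian l X) ∘ₗ creationL
      = LinearMap.mulRight ℂ (gaussian l X) ∘ₗ creationL ∘ₗ (mexp X).mulVecLin := by
    refine linearMap_ext_eigenvectorBasis hX fun k => ?_
    set v : ι → ℂ := (hX.eigenvectorBasis k).ofLp
    set t : ℝ := hX.eigenvalues k
    have hv : X *ᵥ v = (t : ℂ) • v := by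
      rw [hX.mulVec_eigenvectorBasis k]; rfl
    have h2 : mexp X *ᵥ v = (Real.exp t : ℂ) • v := cfc_mulVec_of_mulVec_eq_smul _ hX hv
    have h3 : creation v * (quadHam l X + t • (1 : Matrix (Finset ι) (Finset ι) ℂ))
        = quadHam l X * creation v := by
      rw [quadHam, add_mul, secondQuant_mul_creation, hv, creation_smul, mul_add, mul_add,
        Matrix.mul_smul, Matrix.mul_smul, Matrix.smul_mul, mul_one, one_mul, ← add_assoc]
      rfl
    have h4 := mul_mexp_eq (hK.add (Matrix.isHermitian_one.smul (IsSelfAdjoint.all t))) hK h3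
    rw [mexp_add_smul_one hK] at h4
    simp only [LinearMap.comp_apply, LinearMap.mulLeft_apply, LinearMap.mulRight_apply,
      Matrix.mulVecLin_apply]
    change gaussian l X * creation v = creation (mexp X *ᵥ v) * gaussian l X
    rw [h2, creation_smul, gaussian, ← h4, Matrix.smul_mul, Matrix.mul_smul]
    rfl
  exact LinearMap.congr_fun h φ

/-- Second quantization is multiplicative on symmetric products of positive operators. -/
lemma gaussian_mul_mul {l m : ℝ} {X Y Z : Matrix ι ι ℂ} (hX : X.IsHermitian)
    (hY : Y.IsHermitian) (hZ : Z.IsHermitian) (h : mexp X * mexp Y * mexp X = mexp Z) :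
    gaussian l X * gaussian m Y * gaussian l X = gaussian (2 * l + m) Z := by
  refine ext_of_exchange (fun φ => mexp Z *ᵥ φ) (fun φ => ?_)
    (gaussian_mul_creation _ hZ) ?_
  · rw [mul_assoc, gaussian_mul_creation l hX, mul_assoc, ← mul_assoc (gaussian m Y),
      gaussian_mul_creation m hY, ← mul_assoc, ← mul_assoc, gaussian_mul_creation l hX, ← h,
      Matrix.mulVec_mulVec, Matrix.mulVec_mulVec]
    simp only [mul_assoc]
  · rw [← Matrix.mulVec_mulVec, ← Matrix.mulVec_mulVec, gaussian_mulVec_vacuum l hX,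
      Matrix.mulVec_smul, gaussian_mulVec_vacuum m hY, Matrix.mulVec_smul, Matrix.mulVec_smul,
      gaussian_mulVec_vacuum l hX, gaussian_mulVec_vacuum _ hZ, smul_smul, smul_smul]
    congr 1
    norm_cast
    rw [← Real.exp_add, ← Real.exp_add]
    congr 1; ring

/-! ### Rényi operators of Gaussian operators -/

lemma mpow_gaussian (l : ℝ) {X : Matrix ι ι ℂ} (hX : X.IsHermitian) (p : ℝ) :
    mpow (gaussian l X) p = gaussian (p * l) (p • X) := by
  rw [gaussian, mpow_mexp (isHermitian_quadHam l hX), quadHam_smul]; rfl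

lemma mlog_gaussian (l : ℝ) {X : Matrix ι ι ℂ} (hX : X.IsHermitian) :
    mlog (gaussian l X) = quadHam l X := mlog_mexp (isHermitian_quadHam l hX)

lemma isHermitian_smul_real {κ : Type*} {X : Matrix κ κ ℂ} (hX : X.IsHermitian) (r : ℝ) :
    (r • X).IsHermitian := hX.smul (IsSelfAdjoint.all r)

/-- The logarithm of `e^X e^Y e^X`. -/
lemma exists_mexp_eq_mul_mul {κ : Type*} [Fintype κ] [DecidableEq κ] {X Y : Matrix κ κ ℂ}
    (hX : X.IsHermitian) (hY : Y.IsHermitian) :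
    ∃ Z : Matrix κ κ ℂ, Z.IsHermitian ∧ mexp X * mexp Y * mexp X = mexp Z :=
  have h := posDef_mexp_mul_mul hX hY
  ⟨_, isHermitian_mlog _, (mexp_mlog h.1 (pos_of_mem_spectrum_of_posDef h)).symm⟩

/-- The Rényi operators commute with second quantization. -/
lemma renyiOp_gaussian (α : ℝ) (γ : RenyiIndex) (l m : ℝ) {X Y : Matrix ι ι ℂ}
    (hX : X.IsHermitian) (hY : Y.IsHermitian) :
    ∃ Z : Matrix ι ι ℂ, Z.IsHermitian ∧ renyiOp α γ (mexp X) (mexp Y) = mexp Z ∧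
      renyiOp α γ (gaussian l X) (gaussian m Y) = gaussian (α * l + (1 - α) * m) Z := by
  cases γ with
  | finite z hz =>
    have hX' := isHermitian_smul_real hX (α / (2 * z))
    have hY' := isHermitian_smul_real hY ((1 - α) / z)
    obtain ⟨Z, hZ, h⟩ := exists_mexp_eq_mul_mul hX' hY'
    refine ⟨z • Z, isHermitian_smul_real hZ z, ?_, ?_⟩
    · simp only [renyiOp]
      rw [mpow_mexp hX, mpow_mexp hY, h, mpow_mexp hZ]
    · simp only [renyiOp]
      rw [mpow_gaussian l hX, mpow_gaussian m hY, gaussian_mul_mul hX' hY' hZ h,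
        mpow_gaussian _ hZ]
      congr 1
      field_simp
  | infinity =>
    refine ⟨α • X + (1 - α) • Y,
      (isHermitian_smul_real hX _).add (isHermitian_smul_real hY _), ?_, ?_⟩
    · simp only [renyiOp]
      rw [mlog_mexp hX, mlog_mexp hY]
    · simp only [renyiOp]
      rw [mlog_gaussian l hX, mlog_gaussian m hY, quadHam_smul, quadHam_smul, quadHam_add]
      rfl
  | maximal =>
    have hY1 := isHermitian_smul_real hY (-(1 / 2))
    have hY2 := isHermitian_smul_real hY (1 / 2)
    obtain ⟨Z, hZ, h⟩ := exists_mexp_eq_mul_mul hY1 hX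
    have hZ' := isHermitian_smul_real hZ α
    obtain ⟨W, hW, h'⟩ := exists_mexp_eq_mul_mul hY2 hZ'
    refine ⟨W, hW, ?_, ?_⟩
    · simp only [renyiOp]
      rw [mpow_mexp hY, mpow_mexp hY, h, mpow_mexp hZ, h']
    · simp only [renyiOp]
      rw [mpow_gaussian m hY, mpow_gaussian m hY, gaussian_mul_mul hY1 hX hZ h,
        mpow_gaussian _ hZ, gaussian_mul_mul hY2 hZ' hW h']
      congr 1
      ring

/-! ### Quasi-free densities as Gaussian operators -/

lemma weight_eq_cfc {κ : Type*} [Fintype κ] [DecidableEq κ] {S : Matrix κ κ ℂ}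
    (hS : S.IsHermitian) (h : spectrum ℝ S ⊆ Set.Ioo 0 1) :
    weight S = cfc (fun t : ℝ => t * (1 - t)⁻¹) S := by
  rw [weight, one_sub_eq_cfc hS, cfc_nonsing_inv _ hS (fun t ht => (sub_pos.mpr (h ht).2).ne'),
    cfc_mul_fun (fun t => t), cfc_id_fun hS]

lemma qfFactor_mulVec_vacuum (t : ℝ) {e : ι → ℂ} (he : star e ⬝ᵥ e = 1) :
    qfFactor t e *ᵥ vacuum = (1 - (t : ℂ)) • vacuum := by
  have h : annihilation e *ᵥ (vacuum : Finset ι → ℂ) = 0 := by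
    ext S
    rw [mulVec_vacuum, annihilation, Matrix.conjTranspose_apply, creation, Matrix.sum_apply]
    simp [cre, (Finset.insert_ne_empty _ S).symm]
  rw [qfFactor, annihilation_creation_self he, Matrix.add_mulVec, Matrix.smul_mulVec,
    Matrix.smul_mulVec, Matrix.sub_mulVec, ← Matrix.mulVec_mulVec, h]
  simp

lemma qfDensity_mulVec_vacuum {S : Matrix ι ι ℂ} (hS : S.IsHermitian) :
    qfDensity S *ᵥ vacuum = (∏ i, (1 - (hS.eigenvalues i : ℂ))) • vacuum := by
  have h : ∀ l : List ι, (l.map fun j =>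
      qfFactor (hS.eigenvalues j) (hS.eigenvectorBasis j)).prod *ᵥ vacuum
        = (l.map fun j => 1 - (hS.eigenvalues j : ℂ)).prod • vacuum := by
    intro l
    induction l with
    | nil => simp
    | cons j l ih =>
      rw [List.map_cons, List.prod_cons, ← Matrix.mulVec_mulVec, ih, Matrix.mulVec_smul,
        qfFactor_mulVec_vacuum _ (by simpa using star_dotProduct_eigenvectorBasis hS j j),
        List.map_cons, List.prod_cons, smul_smul, mul_comm]
  rw [qfDensity_eq hS, h, ← Finset.prod_map_toList]
  congr 1
  exact ((Finset.sort_perm_toList _ _).map _).prod_eq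

lemma qfDensity_mul_creation {S : Matrix ι ι ℂ} (hS : S.IsHermitian)
    (h : spectrum ℝ S ⊆ Set.Ioo 0 1) (φ : ι → ℂ) :
    qfDensity S * creation φ = creation (weight S *ᵥ φ) * qfDensity S := by
  have hu : (1 - S) * (1 - S)⁻¹ = 1 := by
    rw [one_sub_eq_cfc hS, cfc_nonsing_inv _ hS (fun t ht => (sub_pos.mpr (h ht).2).ne'),
      ← cfc_mul_fun, ← cfc_one_fun hS]
    exact cfc_congr fun t ht => mul_inv_cancel₀ (sub_pos.mpr (h ht).2).ne'
  set χ := (1 - S)⁻¹ *ᵥ φ with hχ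
  have h1 : φ = χ - S *ᵥ χ := by
    conv_lhs => rw [← Matrix.one_mulVec φ, ← hu, ← Matrix.mulVec_mulVec, Matrix.sub_mulVec,
      Matrix.one_mulVec]
  have h2 : weight S *ᵥ φ = S *ᵥ χ := by rw [weight, hχ, Matrix.mulVec_mulVec]
  have h3 := qfDensity_creation hS χ
  have h4 : creation φ = creation χ - creation (S *ᵥ χ) := by
    rw [eq_sub_iff_add_eq, ← creation_add]
    congr 1
    conv_lhs => rw [h1]
    simp
  rw [h2, h4, mul_sub, h3]
  abel

lemma spectrum_weight_pos {κ : Type*} [Fintype κ] [DecidableEq κ] {S : Matrix κ κ ℂ}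
    (hS : S.IsHermitian) (h : spectrum ℝ S ⊆ Set.Ioo 0 1) :
    (weight S).IsHermitian ∧ ∀ t ∈ spectrum ℝ (weight S), 0 < t := by
  rw [weight_eq_cfc hS h]
  refine ⟨isHermitian_cfc _ _, ?_⟩
  rw [spectrum_cfc _ hS]
  rintro _ ⟨t, ht, rfl⟩
  exact mul_pos (h ht).1 (inv_pos.mpr (sub_pos.mpr (h ht).2))

lemma mexp_mlog_weight {κ : Type*} [Fintype κ] [DecidableEq κ] {S : Matrix κ κ ℂ}
    (hS : S.IsHermitian) (h : spectrum ℝ S ⊆ Set.Ioo 0 1) : mexp (mlog (weight S)) = weight S :=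
  mexp_mlog (spectrum_weight_pos hS h).1 (spectrum_weight_pos hS h).2

/-- The density of the quasi-free state with symbol `S` is `det (I - S) exp (dΓ(log W_S))`. -/
lemma qfDensity_eq_gaussian {S : Matrix ι ι ℂ} (hS : S.IsHermitian)
    (h : spectrum ℝ S ⊆ Set.Ioo 0 1) :
    qfDensity S = gaussian (rtr (mlog (1 - S))) (mlog (weight S)) := by
  have hW := isHermitian_mlog (weight S)
  refine ext_of_exchange (fun φ => weight S *ᵥ φ) (qfDensity_mul_creation hS h) (fun φ => ?_) ?_
  · rw [gaussian_mul_creation _ hW, mexp_mlog_weight hS h]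
  · rw [qfDensity_mulVec_vacuum hS, gaussian_mulVec_vacuum _ hW, mlog, one_sub_eq_cfc hS,
      cfc_cfc _ _ hS, rtr_cfc _ hS, Real.exp_sum]
    congr 1
    push_cast
    refine Finset.prod_congr rfl fun i _ => ?_
    have := (h (hS.eigenvalues_mem_spectrum_real i)).2
    rw [← Complex.ofReal_exp, Real.exp_log (sub_pos.mpr this)]
    push_cast; rfl

/-- The partition function `Tr exp (l + dΓ(Z)) = e^l det (I + e^Z)`. -/
lemma log_rtr_gaussian (l : ℝ) {Z : Matrix ι ι ℂ} (hZ : Z.IsHermitian) :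
    Real.log (rtr (gaussian l Z)) = l + rtr (mlog (1 + mexp Z)) := by
  -- the symbol whose weight is `e^Z`
  set S := cfc (fun t : ℝ => Real.exp t * (1 + Real.exp t)⁻¹) Z with hS_def
  have hS : S.IsHermitian := isHermitian_cfc _ _
  have hp : ∀ t : ℝ, 0 < 1 + Real.exp t := fun t => by positivity
  have hsp : spectrum ℝ S ⊆ Set.Ioo 0 1 := by
    rw [hS_def, spectrum_cfc _ hZ]
    rintro _ ⟨t, -, rfl⟩
    refine ⟨mul_pos (Real.exp_pos t) (inv_pos.mpr (hp t)), ?_⟩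
    change Real.exp t * (1 + Real.exp t)⁻¹ < 1
    rw [← div_eq_mul_inv, div_lt_one (hp t)]
    linarith
  have hone : ∀ t : ℝ, 1 - Real.exp t * (1 + Real.exp t)⁻¹ = (1 + Real.exp t)⁻¹ := fun t => by
    have := (hp t).ne'
    field_simp
    ring
  have hw : mlog (weight S) = Z := by
    rw [weight_eq_cfc hS hsp, hS_def, cfc_cfc _ _ hZ, mlog, cfc_cfc _ _ hZ]
    conv_rhs => rw [← cfc_id_fun hZ]
    refine cfc_congr fun t _ => ?_
    simp only [hone]
    rw [inv_inv, mul_assoc, inv_mul_cancel₀ (hp t).ne', mul_one, Real.log_exp]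
  have hl : mlog (1 - S) = (-1 : ℝ) • mlog (1 + mexp Z) := by
    rw [one_sub_eq_cfc hS, hS_def, cfc_cfc _ _ hZ, mlog, cfc_cfc _ _ hZ,
      one_add_eq_cfc (isHermitian_mexp Z), mexp, cfc_cfc _ _ hZ, mlog, cfc_cfc _ _ hZ,
      ← cfc_smul_fun]
    refine cfc_congr fun t _ => ?_
    simp only [hone, Real.log_inv, neg_one_mul]
  set m := rtr (mlog (1 + mexp Z))
  have h1 : rtr (gaussian (-m) Z) = 1 := by
    have := qfDensity_eq_gaussian hS hsp
    rw [hw, hl, rtr_smul, neg_one_mul] at this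
    rw [← this, rtr, trace_qfDensity hS, Complex.one_re]
  have h2 : gaussian l Z = Real.exp (l + m) • gaussian (-m) Z := by
    rw [gaussian, gaussian, ← mexp_add_smul_one (isHermitian_quadHam _ hZ), quadHam, quadHam,
      add_right_comm, ← add_smul]
    congr 3; ring
  rw [h2, rtr_smul, h1, mul_one, Real.log_exp]

/-- `Tr (ω_S dΓ(X)) = Tr (S X)`. -/
lemma rtr_qfDensity_mul_quadHam {S : Matrix ι ι ℂ} (hS : S.IsHermitian) (l : ℝ)
    (X : Matrix ι ι ℂ) : rtr (qfDensity S * quadHam l X) = l + rtr (S * X) := by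
  have h : ∀ i j, (qfDensity S * (cre i * (cre j)ᴴ)).trace = S j i := by
    intro i j
    have := qfDensity_wick hS (fun _ : Fin 1 => (Pi.single i 1 : ι → ℂ))
      (fun _ : Fin 1 => Pi.single j 1)
    simpa [creationProd, annihilationProd, annihilation, creation, Pi.single_apply, ite_smul,
      dotProduct, apply_ite (star : ℂ → ℂ)] using this
  have h2 : (qfDensity S * secondQuant X).trace = (S * X).trace := by
    simp only [secondQuant, Finset.mul_sum, Matrix.mul_smul, Matrix.trace_sum, Matrix.trace_smul, h]
    rw [Finset.sum_comm]
    simp [Matrix.trace, Matrix.mul_apply, mul_comm]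
  rw [rtr, rtr, quadHam, mul_add, Matrix.trace_add, h2, Matrix.mul_smul, mul_one,
    Matrix.trace_smul, trace_qfDensity hS]
  simp

lemma psi_qfDensity (α : ℝ) (γ : RenyiIndex) {S T : Matrix ι ι ℂ} (hS : S.IsHermitian)
    (hS' : spectrum ℝ S ⊆ Set.Ioo 0 1) (hT : T.IsHermitian) (hT' : spectrum ℝ T ⊆ Set.Ioo 0 1) :
    psi α γ (qfDensity S) (qfDensity T) = psiQf α γ S T := by
  obtain ⟨Z, hZ, h1, h2⟩ := renyiOp_gaussian α γ (rtr (mlog (1 - S))) (rtr (mlog (1 - T)))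
    (isHermitian_mlog (weight S)) (isHermitian_mlog (weight T))
  rw [mexp_mlog_weight hS hS', mexp_mlog_weight hT hT'] at h1
  rw [psi, qfDensity_eq_gaussian hS hS', qfDensity_eq_gaussian hT hT', h2, log_rtr_gaussian _ hZ,
    psiQf, h1]

lemma mlog_weight {κ : Type*} [Fintype κ] [DecidableEq κ] {S : Matrix κ κ ℂ}
    (hS : S.IsHermitian) (h : spectrum ℝ S ⊆ Set.Ioo 0 1) :
    mlog (weight S) = mlog S - mlog (1 - S) := by
  rw [weight_eq_cfc hS h, one_sub_eq_cfc hS]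
  simp only [mlog, cfc_cfc _ _ hS]
  rw [← cfc_sub_fun]
  refine cfc_congr fun t ht => ?_
  rw [Real.log_mul (h ht).1.ne' (inv_pos.mpr (sub_pos.mpr (h ht).2)).ne', Real.log_inv]
  ring

lemma umegaki_qfDensity {S T : Matrix ι ι ℂ} (hS : S.IsHermitian)
    (hS' : spectrum ℝ S ⊆ Set.Ioo 0 1) (hT : T.IsHermitian) (hT' : spectrum ℝ T ⊆ Set.Ioo 0 1) :
    umegaki (qfDensity S) (qfDensity T) = umegakiQf S T := by
  have h1 : mlog (qfDensity S) = quadHam (rtr (mlog (1 - S))) (mlog (weight S)) := by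
    rw [qfDensity_eq_gaussian hS hS', mlog_gaussian _ (isHermitian_mlog _)]
  have h2 : mlog (qfDensity T) = quadHam (rtr (mlog (1 - T))) (mlog (weight T)) := by
    rw [qfDensity_eq_gaussian hT hT', mlog_gaussian _ (isHermitian_mlog _)]
  rw [umegaki, umegakiQf, h1, h2, mul_sub, rtr_sub, rtr_qfDensity_mul_quadHam hS,
    rtr_qfDensity_mul_quadHam hS, mlog_weight hS hS', mlog_weight hT hT']
  simp only [mul_sub, sub_mul, one_mul, rtr_add, rtr_sub]
  ring

lemma belavkinStaszewski_qfDensity {S T : Matrix ι ι ℂ} (hS : S.IsHermitian)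
    (hS' : spectrum ℝ S ⊆ Set.Ioo 0 1) (hT : T.IsHermitian) (hT' : spectrum ℝ T ⊆ Set.Ioo 0 1) :
    belavkinStaszewski (qfDensity S) (qfDensity T) = belavkinStaszewskiQf S T := by
  have hX := isHermitian_mlog (weight S)
  have hY := isHermitian_mlog (weight T)
  have hX' := isHermitian_smul_real hX (1 / 2)
  have hY' := isHermitian_smul_real hY (-1)
  obtain ⟨Z, hZ, h⟩ := exists_mexp_eq_mul_mul hX' hY'
  have h1 : mpow (weight S) (1 / 2) * (weight T)⁻¹ * mpow (weight S) (1 / 2) = mexp Z := by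
    rw [← h, ← mexp_nonsing_inv hY, ← mpow_mexp hX, mexp_mlog_weight hS hS',
      mexp_mlog_weight hT hT']
  have h2 : mpow (qfDensity S) (1 / 2) * (qfDensity T)⁻¹ * mpow (qfDensity S) (1 / 2)
      = gaussian (rtr (mlog (1 - S)) - rtr (mlog (1 - T))) Z := by
    rw [qfDensity_eq_gaussian hS hS', qfDensity_eq_gaussian hT hT', mpow_gaussian _ hX,
      gaussian.eq_1 (rtr (mlog (1 - T))), mexp_nonsing_inv (isHermitian_quadHam _ hY),
      quadHam_smul, ← gaussian.eq_1, gaussian_mul_mul hX' hY' hZ h]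
    congr 1; ring
  rw [belavkinStaszewski, belavkinStaszewskiQf, h1, h2, mlog_gaussian _ hZ,
    rtr_qfDensity_mul_quadHam hS, mlog_mexp hZ, rtr_add, rtr_sub]

lemma renyiD_qfDensity (α : ℝ) (γ : RenyiIndex) {S T : Matrix ι ι ℂ} (hS : S.IsHermitian)
    (hS' : spectrum ℝ S ⊆ Set.Ioo 0 1) (hT : T.IsHermitian) (hT' : spectrum ℝ T ⊆ Set.Ioo 0 1) :
    renyiD α γ (qfDensity S) (qfDensity T) = renyiDQf α γ S T := by
  simp only [renyiD, renyiDQf, psi_qfDensity α γ hS hS' hT hT',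
    umegaki_qfDensity hS hS' hT hT', belavkinStaszewski_qfDensity hS hS' hT hT']

lemma traceLog_eq_psiQf {κ : Type*} [Fintype κ] [DecidableEq κ] (α : ℝ) (γ : RenyiIndex)
    {S T : Matrix κ κ ℂ} (hS : S.IsHermitian) (hS' : spectrum ℝ S ⊆ Set.Ioo 0 1)
    (hT : T.IsHermitian) (hT' : spectrum ℝ T ⊆ Set.Ioo 0 1) :
    psiQf α γ S T = traceLog α γ S T := by
  have h : ∀ {A : Matrix κ κ ℂ} (_ : A.IsHermitian) (_ : spectrum ℝ A ⊆ Set.Ioo 0 1) (p : ℝ),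
      mlog (mpow (1 - A) p) = p • mlog (1 - A) := fun {A} hA hA' p => by
    rw [mlog, mlog, mpow, one_sub_eq_cfc hA, cfc_cfc _ _ hA, cfc_cfc _ _ hA, cfc_cfc _ _ hA,
      ← cfc_smul_fun]
    refine cfc_congr fun t ht => ?_
    exact Real.log_rpow (sub_pos.mpr (hA' ht).2) p
  rw [traceLog, psiQf, h hS hS', h hT hT', rtr_add, rtr_add, rtr_smul, rtr_smul]

end SecondQuantization

/-! ### Asymptotic symbols of matrix sequences -/

section Frobenius

open scoped Matrix.Norms.L2Operator

/-- The squared Frobenius (Hilbert–Schmidt) norm. -/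
def frobSq {m n : Type*} [Fintype m] [Fintype n] (D : Matrix m n ℂ) : ℝ := ∑ i, ∑ j, ‖D i j‖ ^ 2

variable {m n : Type*} [Fintype m] [Fintype n]

lemma frobSq_nonneg (D : Matrix m n ℂ) : 0 ≤ frobSq D :=
  Finset.sum_nonneg fun _ _ => Finset.sum_nonneg fun _ _ => sq_nonneg _

lemma frobSq_zero : frobSq (0 : Matrix m n ℂ) = 0 := by simp [frobSq]

lemma frobSq_conjTranspose (D : Matrix m n ℂ) : frobSq Dᴴ = frobSq D := by
  simp only [frobSq, Matrix.conjTranspose_apply, norm_star]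
  exact Finset.sum_comm

lemma frobSq_neg (D : Matrix m n ℂ) : frobSq (-D) = frobSq D := by simp [frobSq]

lemma frobSq_add_le (D E : Matrix m n ℂ) : frobSq (D + E) ≤ 2 * (frobSq D + frobSq E) := by
  simp only [frobSq, ← Finset.sum_add_distrib, Finset.mul_sum]
  refine Finset.sum_le_sum fun i _ => Finset.sum_le_sum fun j _ => ?_
  have h := norm_add_le (D i j) (E i j)
  have h0 := norm_nonneg (D i j + E i j)
  rw [Matrix.add_apply]
  nlinarith [sq_nonneg (‖D i j‖ - ‖E i j‖)]

lemma frobSq_mul_le_left [DecidableEq m] (A : Matrix m m ℂ) (D : Matrix m n ℂ) :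
    frobSq (A * D) ≤ ‖A‖ ^ 2 * frobSq D := by
  have hc : ∀ E : Matrix m n ℂ, frobSq E = ∑ j, ∑ i, ‖E i j‖ ^ 2 := fun E => Finset.sum_comm
  rw [hc, hc, Finset.mul_sum]
  refine Finset.sum_le_sum fun j _ => ?_
  have h := Matrix.l2_opNorm_mulVec A (WithLp.toLp 2 (fun i => D i j))
  have h2 := pow_le_pow_left₀ (norm_nonneg _) h 2
  rw [mul_pow, EuclideanSpace.norm_sq_eq, EuclideanSpace.norm_sq_eq] at h2
  exact h2

lemma frobSq_mul_le_right [DecidableEq n] (D : Matrix m n ℂ) (A : Matrix n n ℂ) :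
    frobSq (D * A) ≤ ‖A‖ ^ 2 * frobSq D := by
  rw [← frobSq_conjTranspose, Matrix.conjTranspose_mul, ← frobSq_conjTranspose D,
    ← Matrix.l2_opNorm_conjTranspose A]
  exact frobSq_mul_le_left _ _

end Frobenius

local notation "μT" => (AddCircle.haarAddCircle (T := 2 * Real.pi))

/-- Square matrices over the modes at the sites `0, …, n-1`. -/
abbrev SiteMatrix (n d : ℕ) : Type := Matrix (Fin n ×ₗ Fin d) (Fin n ×ₗ Fin d) ℂ

section Wave

variable {d : ℕ}

/-- The values at `x` of the plane waves `e^{ikx} e_i`, `k < n`, `i < d`, as the columns of a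
matrix: this is the isometric embedding of `ℂ^n ⊗ ℂ^d` into `L²(𝕋; ℂ^d)`. -/
def wave (n d : ℕ) (x : Torus) : Matrix (Fin d) (Fin n ×ₗ Fin d) ℂ :=
  Matrix.of fun i b => if i = (ofLex b).2 then fourier ((ofLex b).1 : ℤ) x else 0

/-- The failure of a matrix `X` on the sites `0, …, n-1` to be intertwined with multiplication by
the function `a` under the embedding `wave`. -/
def defect {n : ℕ} (X : SiteMatrix n d) (a : Torus → Matrix (Fin d) (Fin d) ℂ) (x : Torus) :
    Matrix (Fin d) (Fin n ×ₗ Fin d) ℂ :=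
  wave n d x * X - a x * wave n d x

lemma continuous_wave (n d : ℕ) : Continuous (wave n d) := by
  refine continuous_matrix fun i b => ?_
  simp only [wave, Matrix.of_apply]
  split_ifs
  · exact (fourier _).continuous
  · exact continuous_const

lemma norm_fourier_apply (k : ℤ) (x : Torus) : ‖(fourier k x : ℂ)‖ = 1 := Circle.norm_coe _

lemma sum_site {M : Type*} [AddCommMonoid M] {n : ℕ} (f : Fin n ×ₗ Fin d → M) :
    ∑ b, f b = ∑ k, ∑ i, f (toLex (k, i)) := by
  rw [← Fintype.sum_prod_type (fun p : Fin n × Fin d => f (toLex p))]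
  exact (Equiv.sum_comp toLex f).symm

lemma wave_toLex (n : ℕ) (x : Torus) (i m : Fin d) (k : Fin n) :
    wave n d x i (toLex (k, m)) = if i = m then (fourier (k : ℤ) x : ℂ) else 0 := rfl

lemma frobSq_wave (n : ℕ) (x : Torus) : frobSq (wave n d x) = n * d := by
  have h : ∀ (i j : Fin d) (k : ℤ),
      ‖if i = j then (fourier k x : ℂ) else 0‖ ^ 2 = if i = j then 1 else 0 := fun i j k => by
    split_ifs
    · rw [norm_fourier_apply, one_pow]
    · simp
  simp only [frobSq, sum_site, wave_toLex, h, Finset.sum_ite_eq, Finset.mem_univ, if_true]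
  simp [mul_comm]

lemma aestronglyMeasurable_frobSq_defect {n : ℕ} (X : SiteMatrix n d)
    {a : Torus → Matrix (Fin d) (Fin d) ℂ} (ha : AEStronglyMeasurable a μT) :
    AEStronglyMeasurable (fun x => frobSq (defect X a x)) μT := by
  have hw : ∀ (i : Fin d) (b : Fin n ×ₗ Fin d),
      AEStronglyMeasurable (fun x => wave n d x i b) μT := fun i b =>
    ((continuous_wave n d).matrix_elem i b).aestronglyMeasurable
  have ha' : ∀ i j : Fin d, AEStronglyMeasurable (fun x => a x i j) μT := fun i j =>
    (continuous_id.matrix_elem i j).comp_aestronglyMeasurable ha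
  simp only [frobSq, defect, Matrix.sub_apply, Matrix.mul_apply]
  refine Finset.aestronglyMeasurable_fun_sum _ fun i _ =>
    Finset.aestronglyMeasurable_fun_sum _ fun b _ => AEStronglyMeasurable.pow ?_ 2
  exact ((Finset.aestronglyMeasurable_fun_sum _ fun b' _ => (hw i b').mul_const _).sub
    (Finset.aestronglyMeasurable_fun_sum _ fun j _ => (ha' i j).mul (hw j b))).norm

end Wave

section Symbol

open scoped Matrix.Norms.L2Operator

variable {d : ℕ}

/-- A bounded sequence of matrices `X n` on the sites `0, …, n-1` has asymptotic symbol `a` if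
plane waves intertwine it with multiplication by the bounded function `a`, up to an error of
squared Hilbert–Schmidt norm `o(n)`. -/
structure HasAsympSymbol (X : ∀ n, SiteMatrix n d) (a : Torus → Matrix (Fin d) (Fin d) ℂ) :
    Prop where
  meas : AEStronglyMeasurable a μT
  bound : ∃ M : ℝ, (∀ n, ‖X n‖ ≤ M) ∧ ∀ᵐ x ∂μT, ‖a x‖ ≤ M
  tendsto : Tendsto (fun n : ℕ => 1 / (n : ℝ) * ∫ x, frobSq (defect (X n) a x) ∂μT) atTop (𝓝 0)

lemma integrable_frobSq_defect {n : ℕ} (X : SiteMatrix n d)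
    {a : Torus → Matrix (Fin d) (Fin d) ℂ} (ha : AEStronglyMeasurable a μT) {M : ℝ}
    (hM : ∀ᵐ x ∂μT, ‖a x‖ ≤ M) : Integrable (fun x => frobSq (defect X a x)) μT := by
  refine Integrable.of_bound (aestronglyMeasurable_frobSq_defect X ha)
    (2 * (‖X‖ ^ 2 * (n * d) + M ^ 2 * (n * d))) ?_
  filter_upwards [hM] with x hx
  rw [Real.norm_of_nonneg (frobSq_nonneg _), defect, sub_eq_add_neg]
  refine (frobSq_add_le _ _).trans ?_
  rw [frobSq_neg]
  have h1 := frobSq_mul_le_right (wave n d x) X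
  have h2 := frobSq_mul_le_left (a x) (wave n d x)
  rw [frobSq_wave] at h1 h2
  have h3 : ‖a x‖ ^ 2 * (n * d : ℝ) ≤ M ^ 2 * (n * d) := by gcongr
  linarith

lemma HasAsympSymbol.integrable {X : ∀ n, SiteMatrix n d}
    {a : Torus → Matrix (Fin d) (Fin d) ℂ} (h : HasAsympSymbol X a) (n : ℕ) :
    Integrable (fun x => frobSq (defect (X n) a x)) μT := by
  obtain ⟨M, -, hM⟩ := h.bound
  exact integrable_frobSq_defect _ h.meas hM

/-- A sequence whose defect is dominated by those of two sequences with asymptotic symbols. -/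
lemma tendsto_defect_of_le {X Y Z : ∀ n, SiteMatrix n d}
    {a b c : Torus → Matrix (Fin d) (Fin d) ℂ} (hX : HasAsympSymbol X a)
    (hY : HasAsympSymbol Y b) (C : ℝ)
    (h : ∀ n, ∀ᵐ x ∂μT, frobSq (defect (Z n) c x)
      ≤ C * (frobSq (defect (X n) a x) + frobSq (defect (Y n) b x))) :
    Tendsto (fun n : ℕ => 1 / (n : ℝ) * ∫ x, frobSq (defect (Z n) c x) ∂μT) atTop (𝓝 0) := by
  have h0 := (hX.tendsto.add hY.tendsto).const_mul C
  rw [add_zero, mul_zero] at h0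
  refine squeeze_zero (fun n => mul_nonneg (by positivity)
    (integral_nonneg fun x => frobSq_nonneg _)) (fun n => ?_) h0
  have h1 : ∫ x, frobSq (defect (Z n) c x) ∂μT
      ≤ C * (∫ x, frobSq (defect (X n) a x) ∂μT + ∫ x, frobSq (defect (Y n) b x) ∂μT) := by
    rw [← integral_add (hX.integrable n) (hY.integrable n), ← integral_const_mul]
    exact integral_mono_of_nonneg (Eventually.of_forall fun x => frobSq_nonneg _)
      (((hX.integrable n).add (hY.integrable n)).const_mul C) (h n)
  calc _ ≤ 1 / (n : ℝ) * _ := mul_le_mul_of_nonneg_left h1 (by positivity)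
    _ = _ := by ring

lemma HasAsympSymbol.add {X Y : ∀ n, SiteMatrix n d} {a b : Torus → Matrix (Fin d) (Fin d) ℂ}
    (hX : HasAsympSymbol X a) (hY : HasAsympSymbol Y b) :
    HasAsympSymbol (fun n => X n + Y n) fun x => a x + b x where
  meas := hX.meas.add hY.meas
  bound := by
    obtain ⟨M, h1, h2⟩ := hX.bound
    obtain ⟨N, h3, h4⟩ := hY.bound
    refine ⟨M + N, fun n => (norm_add_le _ _).trans (add_le_add (h1 n) (h3 n)), ?_⟩
    filter_upwards [h2, h4] with x hx hx'
    exact (norm_add_le _ _).trans (add_le_add hx hx')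
  tendsto := tendsto_defect_of_le hX hY 2 fun n => Eventually.of_forall fun x => by
    have : defect (X n + Y n) (fun x => a x + b x) x = defect (X n) a x + defect (Y n) b x := by
      simp only [defect, Matrix.mul_add, Matrix.add_mul]; abel
    rw [this]
    exact frobSq_add_le _ _

lemma HasAsympSymbol.mul {X Y : ∀ n, SiteMatrix n d} {a b : Torus → Matrix (Fin d) (Fin d) ℂ}
    (hX : HasAsympSymbol X a) (hY : HasAsympSymbol Y b) :
    HasAsympSymbol (fun n => X n * Y n) fun x => a x * b x where
  meas := hX.meas.mul hY.meas
  bound := by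
    obtain ⟨M, h1, h2⟩ := hX.bound
    obtain ⟨N, h3, h4⟩ := hY.bound
    have hM : 0 ≤ M := (norm_nonneg _).trans (h1 0)
    refine ⟨M * N, fun n => (norm_mul_le _ _).trans
      (mul_le_mul (h1 n) (h3 n) (norm_nonneg _) hM), ?_⟩
    filter_upwards [h2, h4] with x hx hx'
    exact (norm_mul_le _ _).trans (mul_le_mul hx hx' (norm_nonneg _) hM)
  tendsto := by
    obtain ⟨M, -, h2⟩ := hX.bound
    obtain ⟨N, h3, -⟩ := hY.bound
    refine tendsto_defect_of_le hX hY (2 * (N ^ 2 + M ^ 2)) fun n => ?_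
    filter_upwards [h2] with x hx
    -- the defect obeys a Leibniz rule
    have : defect (X n * Y n) (fun x => a x * b x) x
        = defect (X n) a x * Y n + a x * defect (Y n) b x := by
      simp only [defect, Matrix.mul_assoc, Matrix.mul_sub, Matrix.sub_mul]
      abel
    rw [this]
    refine (frobSq_add_le _ _).trans ?_
    have e1 := frobSq_mul_le_right (defect (X n) a x) (Y n)
    have e2 := frobSq_mul_le_left (a x) (defect (Y n) b x)
    have p1 := frobSq_nonneg (defect (X n) a x)
    have p2 := frobSq_nonneg (defect (Y n) b x)
    have e3 : ‖Y n‖ ^ 2 ≤ N ^ 2 := pow_le_pow_left₀ (norm_nonneg _) (h3 n) 2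
    have e4 : ‖a x‖ ^ 2 ≤ M ^ 2 := pow_le_pow_left₀ (norm_nonneg _) hx 2
    nlinarith [mul_le_mul_of_nonneg_right e3 p1, mul_le_mul_of_nonneg_right e4 p2,
      mul_nonneg (sq_nonneg M) p1, mul_nonneg (sq_nonneg N) p2]

lemma hasAsympSymbol_algebraMap (r : ℝ) :
    HasAsympSymbol (d := d) (fun n => algebraMap ℝ (SiteMatrix n d) r)
      fun _ => algebraMap ℝ (Matrix (Fin d) (Fin d) ℂ) r where
  meas := aestronglyMeasurable_const
  bound := by
    have h1 : ∀ (κ : Type) [Fintype κ] [DecidableEq κ],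
        ‖algebraMap ℝ (Matrix κ κ ℂ) r‖ ≤ |r| := fun κ _ _ => by
      have h := Matrix.l2_opNorm_diagonal (𝕜 := ℂ) (fun _ : κ => (r : ℂ))
      have h' : algebraMap ℝ (Matrix κ κ ℂ) r = Matrix.diagonal fun _ : κ => (r : ℂ) := by
        rw [Matrix.algebraMap_eq_diagonal]; rfl
      rw [h', h]
      refine (pi_norm_le_iff_of_nonneg (abs_nonneg r)).mpr fun i => ?_
      simp
    exact ⟨|r|, fun n => h1 _, Eventually.of_forall fun _ => h1 _⟩
  tendsto := by
    have : ∀ (n : ℕ) (x : Torus), defect (algebraMap ℝ (SiteMatrix n d) r)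
        (fun _ => algebraMap ℝ (Matrix (Fin d) (Fin d) ℂ) r) x = 0 := fun n x => by
      rw [defect, Algebra.algebraMap_eq_smul_one, Algebra.algebraMap_eq_smul_one, Matrix.mul_smul,
        Matrix.smul_mul, Matrix.mul_one, Matrix.one_mul, sub_self]
    simp [this, frobSq_zero]

lemma HasAsympSymbol.smul {X : ∀ n, SiteMatrix n d} {a : Torus → Matrix (Fin d) (Fin d) ℂ}
    (hX : HasAsympSymbol X a) (r : ℝ) :
    HasAsympSymbol (fun n => r • X n) fun x => r • a x := by
  simpa only [Algebra.algebraMap_eq_smul_one, smul_mul_assoc, one_mul]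
    using (hasAsympSymbol_algebraMap r).mul hX

lemma HasAsympSymbol.sub {X Y : ∀ n, SiteMatrix n d} {a b : Torus → Matrix (Fin d) (Fin d) ℂ}
    (hX : HasAsympSymbol X a) (hY : HasAsympSymbol Y b) :
    HasAsympSymbol (fun n => X n - Y n) fun x => a x - b x := by
  simpa only [neg_one_smul, ← sub_eq_add_neg] using hX.add (hY.smul (-1))

lemma HasAsympSymbol.congr {X Y : ∀ n, SiteMatrix n d} {a b : Torus → Matrix (Fin d) (Fin d) ℂ}
    (hX : HasAsympSymbol X a) (h1 : ∀ n, Y n = X n) (h2 : ∀ᵐ x ∂μT, b x = a x) :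
    HasAsympSymbol Y b where
  meas := hX.meas.congr (by filter_upwards [h2] with x hx using hx.symm)
  bound := by
    obtain ⟨M, h3, h4⟩ := hX.bound
    refine ⟨M, fun n => h1 n ▸ h3 n, ?_⟩
    filter_upwards [h2, h4] with x hx hx'
    rwa [hx]
  tendsto := by
    refine hX.tendsto.congr fun n => ?_
    congr 1
    refine integral_congr_ae ?_
    filter_upwards [h2] with x hx
    simp only [defect, h1, hx]

lemma HasAsympSymbol.aeval {X : ∀ n, SiteMatrix n d} {a : Torus → Matrix (Fin d) (Fin d) ℂ}
    (hX : HasAsympSymbol X a) (p : Polynomial ℝ) :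
    HasAsympSymbol (fun n => Polynomial.aeval (X n) p) fun x => Polynomial.aeval (a x) p := by
  induction p using Polynomial.induction_on' with
  | add p q hp hq => simpa only [map_add] using hp.add hq
  | monomial n r =>
    simp only [Polynomial.aeval_monomial]
    refine (hasAsympSymbol_algebraMap r).mul ?_
    induction n with
    | zero => simpa only [pow_zero, map_one] using hasAsympSymbol_algebraMap 1
    | succ n ih => simpa only [pow_succ] using ih.mul hX

/-! ### Functional calculus of asymptotic symbols -/

/-- `A` is Hermitian with spectrum in `s`. -/
def SpecIn {κ : Type*} [Fintype κ] [DecidableEq κ] (s : Set ℝ) (A : Matrix κ κ ℂ) : Prop :=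
  A.IsHermitian ∧ spectrum ℝ A ⊆ s

lemma norm_cfc_sub_aeval_le {κ : Type*} [Fintype κ] [DecidableEq κ] {s : Set ℝ}
    {A : Matrix κ κ ℂ} (hA : SpecIn s A) {f : ℝ → ℝ} {p : Polynomial ℝ} {ε : ℝ} (hε : 0 ≤ ε)
    (h : ∀ t ∈ s, |p.eval t - f t| ≤ ε) : ‖cfc f A - Polynomial.aeval A p‖ ≤ ε := by
  rw [← cfc_polynomial p A hA.1.isSelfAdjoint, ← cfc_sub_fun]
  refine norm_cfc_le hε fun t ht => ?_
  rw [Real.norm_eq_abs, abs_sub_comm]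
  exact h t (hA.2 ht)

lemma HasAsympSymbol.functionalCalculus {X : ∀ n, SiteMatrix n d}
    {a : Torus → Matrix (Fin d) (Fin d) ℂ}
    (h : HasAsympSymbol X a) {l u : ℝ} (hX : ∀ n, SpecIn (Set.Icc l u) (X n))
    (ha : ∀ᵐ x ∂μT, SpecIn (Set.Icc l u) (a x)) {f : ℝ → ℝ}
    (hf : ContinuousOn f (Set.Icc l u)) :
    HasAsympSymbol (fun n => cfc f (X n)) fun x => cfc f (a x) := by
  have hp : ∀ ε > 0, ∃ p : Polynomial ℝ, ∀ t ∈ Set.Icc l u, |p.eval t - f t| ≤ ε := fun ε hε => by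
    obtain ⟨p, hp⟩ := exists_polynomial_near_of_continuousOn l u f hf ε hε
    exact ⟨p, fun t ht => (hp t ht).le⟩
  have hmeas : AEStronglyMeasurable (fun x => cfc f (a x)) μT := by
    choose p hp using fun k : ℕ => hp (1 / ((k : ℝ) + 1)) (by positivity)
    refine aestronglyMeasurable_of_tendsto_ae atTop (fun k => (h.aeval (p k)).meas) ?_
    filter_upwards [ha] with x hx
    rw [tendsto_iff_norm_sub_tendsto_zero]
    refine squeeze_zero (fun k => norm_nonneg _) (fun k => ?_)
      tendsto_one_div_add_atTop_nhds_zero_nat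
    rw [norm_sub_rev]
    exact norm_cfc_sub_aeval_le hx (by positivity) (hp k)
  have hbound : ∃ M : ℝ, (∀ n, ‖cfc f (X n)‖ ≤ M) ∧ ∀ᵐ x ∂μT, ‖cfc f (a x)‖ ≤ M := by
    obtain ⟨C, hC⟩ := isCompact_Icc.exists_bound_of_continuousOn hf
    have key : ∀ {κ : Type} [Fintype κ] [DecidableEq κ] {A : Matrix κ κ ℂ},
        SpecIn (Set.Icc l u) A → ‖cfc f A‖ ≤ max C 0 := fun hA =>
      norm_cfc_le (le_max_right _ _) fun t ht => (hC t (hA.2 ht)).trans (le_max_left _ _)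
    refine ⟨max C 0, fun n => key (hX n), ?_⟩
    filter_upwards [ha] with x hx using key hx
  refine ⟨hmeas, hbound, ?_⟩
  obtain ⟨M, -, hM⟩ := hbound
  refine Metric.tendsto_atTop.mpr fun δ hδ => ?_
  -- approximate `f` within `ε`, where `8 ε² d < δ / 2`
  obtain ⟨ε, hε, hεδ⟩ : ∃ ε : ℝ, 0 < ε ∧ 8 * ε ^ 2 * d < δ / 2 := by
    have h1 : Tendsto (fun ε : ℝ => 8 * ε ^ 2 * d) (𝓝 0) (𝓝 (8 * (0 : ℝ) ^ 2 * d)) :=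
      Continuous.tendsto (by fun_prop) 0
    have h2 : ∀ᶠ ε : ℝ in 𝓝[>] 0, 8 * ε ^ 2 * d < δ / 2 :=
      (h1.mono_left nhdsWithin_le_nhds).eventually_lt_const (by simpa using half_pos hδ)
    obtain ⟨ε, h3, h4⟩ := (h2.and self_mem_nhdsWithin).exists
    exact ⟨ε, h4, h3⟩
  obtain ⟨p, hp⟩ := hp ε hε
  obtain ⟨N, hN⟩ := Metric.tendsto_atTop.mp (h.aeval p).tendsto (δ / 4) (by positivity)
  refine ⟨N + 1, fun n hn => ?_⟩
  have hn0 : (0 : ℝ) < n := by exact_mod_cast (by omega : 0 < n)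
  have hle : ∫ x, frobSq (defect (cfc f (X n)) (fun x => cfc f (a x)) x) ∂μT
      ≤ ∫ x, (2 * frobSq (defect (Polynomial.aeval (X n) p) (fun x => Polynomial.aeval (a x) p) x)
        + 8 * ε ^ 2 * (n * d)) ∂μT := by
    refine integral_mono_ae (integrable_frobSq_defect _ hmeas hM)
      ((((h.aeval p).integrable n).const_mul 2).add (integrable_const _)) ?_
    filter_upwards [ha] with x hx
    have e : defect (cfc f (X n)) (fun x => cfc f (a x)) x
        = defect (Polynomial.aeval (X n) p) (fun x => Polynomial.aeval (a x) p) x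
          + (wave n d x * (cfc f (X n) - Polynomial.aeval (X n) p)
            + -((cfc f (a x) - Polynomial.aeval (a x) p) * wave n d x)) := by
      simp only [defect, Matrix.mul_sub, Matrix.sub_mul]; abel
    rw [e]
    have e1 := frobSq_add_le (defect (Polynomial.aeval (X n) p)
      (fun x => Polynomial.aeval (a x) p) x)
      (wave n d x * (cfc f (X n) - Polynomial.aeval (X n) p)
            + -((cfc f (a x) - Polynomial.aeval (a x) p) * wave n d x))
    have e2 := frobSq_add_le (wave n d x * (cfc f (X n) - Polynomial.aeval (X n) p))
      (-((cfc f (a x) - Polynomial.aeval (a x) p) * wave n d x))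
    have e3 := frobSq_mul_le_right (wave n d x) (cfc f (X n) - Polynomial.aeval (X n) p)
    have e4 := frobSq_mul_le_left (cfc f (a x) - Polynomial.aeval (a x) p) (wave n d x)
    rw [frobSq_wave] at e3 e4
    rw [frobSq_neg] at e2
    have e5 : ‖cfc f (X n) - Polynomial.aeval (X n) p‖ ^ 2 * (n * d : ℝ) ≤ ε ^ 2 * (n * d) := by
      gcongr
      exact norm_cfc_sub_aeval_le (hX n) hε.le hp
    have e6 : ‖cfc f (a x) - Polynomial.aeval (a x) p‖ ^ 2 * (n * d : ℝ) ≤ ε ^ 2 * (n * d) := by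
      gcongr
      exact norm_cfc_sub_aeval_le hx hε.le hp
    linarith
  rw [integral_add (((h.aeval p).integrable n).const_mul 2) (integrable_const _),
    integral_const_mul, integral_const, probReal_univ, one_smul] at hle
  have h5 := hN n (by omega)
  rw [Real.dist_eq, sub_zero] at h5 ⊢
  have h6 := (le_abs_self _).trans_lt h5
  rw [abs_of_nonneg (mul_nonneg (by positivity) (integral_nonneg fun x => frobSq_nonneg _))]
  calc _ ≤ 1 / (n : ℝ) * _ := mul_le_mul_of_nonneg_left hle (by positivity)
    _ = 2 * (1 / (n : ℝ) * ∫ x, frobSq (defect (Polynomial.aeval (X n) p)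
          (fun x => Polynomial.aeval (a x) p) x) ∂μT) + 8 * ε ^ 2 * d := by
        field_simp
    _ < δ := by linarith

/-! ### The trace formula -/

lemma wave_mul_conjTranspose (n : ℕ) (x : Torus) :
    wave n d x * (wave n d x)ᴴ = (n : ℂ) • (1 : Matrix (Fin d) (Fin d) ℂ) := by
  have h : ∀ k : ℤ, (fourier k x : ℂ) * star (fourier k x : ℂ) = 1 := fun k => by
    have := Complex.mul_conj (fourier k x : ℂ)
    rw [Complex.normSq_eq_norm_sq, norm_fourier_apply] at this
    rw [← starRingEnd_apply, this]
    norm_num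
  ext i j
  rw [Matrix.mul_apply, sum_site]
  have e : ∀ (k : Fin n) (m : Fin d), wave n d x i (toLex (k, m)) * (wave n d x)ᴴ (toLex (k, m)) j
      = if i = m then (if i = j then 1 else 0) else 0 := fun k m => by
    rw [Matrix.conjTranspose_apply, wave_toLex, wave_toLex]
    by_cases him : i = m
    · subst him
      by_cases hji : j = i
      · subst hji
        rw [if_pos rfl, h, if_pos rfl, if_pos rfl]
      · rw [if_neg hji, if_neg (Ne.symm hji), star_zero, mul_zero, ite_self]
    · rw [if_neg him, zero_mul, if_neg him]
  simp only [e, Finset.sum_ite_eq, Finset.mem_univ, if_true, Finset.sum_const, Finset.card_univ,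
    Fintype.card_fin, Matrix.smul_apply, Matrix.one_apply, nsmul_eq_mul, smul_eq_mul]

lemma integral_fourier (m : ℤ) : ∫ x, (fourier m x : ℂ) ∂μT = if m = 0 then 1 else 0 := by
  have h := congrFun (fourierCoeff_fourier (T := 2 * Real.pi) m) 0
  simp only [fourierCoeff, neg_zero, fourier_zero, smul_eq_mul, one_mul] at h
  rw [h, Pi.single_apply]
  simp only [eq_comm]

lemma conjTranspose_wave_mul_apply (n : ℕ) (x : Torus) (b b' : Fin n ×ₗ Fin d) :
    ((wave n d x)ᴴ * wave n d x) b b'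
      = if (ofLex b).2 = (ofLex b').2
        then (fourier (((ofLex b').1 : ℤ) - ((ofLex b).1 : ℤ)) x : ℂ) else 0 := by
  rw [Matrix.mul_apply]
  simp only [wave, Matrix.conjTranspose_apply, Matrix.of_apply]
  rw [Finset.sum_eq_single (ofLex b).2 (fun i _ hi => by rw [if_neg hi, star_zero, zero_mul])
    (by simp), if_pos rfl]
  split_ifs
  · rw [sub_eq_add_neg, fourier_add, fourier_neg, mul_comm]; rfl
  · rw [mul_zero]

lemma integral_conjTranspose_wave_mul (n : ℕ) (b b' : Fin n ×ₗ Fin d) :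
    ∫ x, ((wave n d x)ᴴ * wave n d x) b b' ∂μT = (1 : SiteMatrix n d) b b' := by
  simp only [conjTranspose_wave_mul_apply, Matrix.one_apply]
  split_ifs with h1 h2 h2
  · subst h2
    rw [sub_self, integral_fourier, if_pos rfl]
  · rw [integral_fourier, if_neg]
    intro h3
    refine h2 (ofLex.injective (Prod.ext (Fin.ext ?_) h1))
    omega
  · exact absurd (h2 ▸ rfl) h1
  · simp

lemma trace_conjTranspose_wave_mul_defect {n : ℕ} (X : SiteMatrix n d)
    (a : Torus → Matrix (Fin d) (Fin d) ℂ) (x : Torus) :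
    ((wave n d x)ᴴ * defect X a x).trace
      = ((wave n d x)ᴴ * wave n d x * X).trace - n * (a x).trace := by
  rw [defect, Matrix.mul_sub, Matrix.trace_sub, ← Matrix.mul_assoc, ← Matrix.mul_assoc,
    Matrix.trace_mul_cycle _ (a x), wave_mul_conjTranspose, Matrix.smul_mul, Matrix.trace_smul,
    Matrix.one_mul, smul_eq_mul]

lemma continuous_rtr {κ : Type*} [Fintype κ] : Continuous (rtr : Matrix κ κ ℂ → ℝ) := by
  unfold rtr
  exact Complex.continuous_re.comp (continuous_id.matrix_trace)

lemma integral_rtr_conjTranspose_wave_mul {n : ℕ} (X : SiteMatrix n d) :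
    Integrable (fun x => rtr ((wave n d x)ᴴ * wave n d x * X)) μT ∧
      ∫ x, rtr ((wave n d x)ᴴ * wave n d x * X) ∂μT = rtr X := by
  have hi : ∀ b b', Integrable (fun x => ((wave n d x)ᴴ * wave n d x) b b') μT := fun b b' => by
    have hc : Continuous fun x => ((wave n d x)ᴴ * wave n d x) b b' :=
      ((continuous_wave n d).matrix_conjTranspose.matrix_mul (continuous_wave n d)).matrix_elem b b'
    exact hc.integrable_of_hasCompactSupport (HasCompactSupport.of_compactSpace _)
  have e : ∀ x, ((wave n d x)ᴴ * wave n d x * X).trace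
      = ∑ b, ∑ b', ((wave n d x)ᴴ * wave n d x) b b' * X b' b := fun x => by
    refine Finset.sum_congr rfl fun b _ => ?_
    rw [Matrix.diag_apply, Matrix.mul_apply]
  have hi' : ∀ b b', Integrable (fun x => ((wave n d x)ᴴ * wave n d x) b b' * X b' b) μT :=
    fun b b' => (hi b b').mul_const _
  have hI : Integrable (fun x => ((wave n d x)ᴴ * wave n d x * X).trace) μT := by
    simp only [e]
    exact integrable_finsetSum _ fun b _ => integrable_finsetSum _ fun b' _ => hi' b b'
  have h1 : ∫ x, ((wave n d x)ᴴ * wave n d x * X).trace ∂μT = X.trace := by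
    simp only [e]
    rw [integral_finsetSum _ fun b _ => integrable_finsetSum _ fun b' _ => hi' b b']
    refine Finset.sum_congr rfl fun b _ => ?_
    rw [integral_finsetSum _ fun b' _ => hi' b b']
    simp only [integral_mul_const, integral_conjTranspose_wave_mul]
    rw [← Matrix.mul_apply, Matrix.one_mul, Matrix.diag_apply]
  refine ⟨hI.re, ?_⟩
  rw [rtr, ← h1]
  exact integral_re hI

/-- Weighted Cauchy–Schwarz inequality for the Hilbert–Schmidt inner product. -/
lemma abs_rtr_conjTranspose_mul_le {m n : Type*} [Fintype m] [Fintype n] (D E : Matrix m n ℂ)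
    {η : ℝ} (hη : 0 < η) : |rtr (Dᴴ * E)| ≤ η * frobSq D + η⁻¹ * frobSq E := by
  refine (Complex.abs_re_le_norm _).trans ?_
  simp only [Matrix.trace, Matrix.diag_apply, Matrix.mul_apply, Matrix.conjTranspose_apply]
  rw [Finset.sum_comm]
  simp only [frobSq, Finset.mul_sum, ← Finset.sum_add_distrib]
  refine (norm_sum_le _ _).trans (Finset.sum_le_sum fun i _ => (norm_sum_le _ _).trans
    (Finset.sum_le_sum fun j _ => ?_))
  rw [norm_mul, norm_star]
  have h : 0 ≤ η⁻¹ * (η * ‖D i j‖ - ‖E i j‖) ^ 2 := by positivity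
  have h2 : η⁻¹ * (η * ‖D i j‖ - ‖E i j‖) ^ 2
      = η * ‖D i j‖ ^ 2 + η⁻¹ * ‖E i j‖ ^ 2 - 2 * (‖D i j‖ * ‖E i j‖) := by
    field_simp
    ring
  have h3 : 0 ≤ ‖D i j‖ * ‖E i j‖ := by positivity
  linarith

lemma frobSq_one {κ : Type*} [Fintype κ] [DecidableEq κ] :
    frobSq (1 : Matrix κ κ ℂ) = Fintype.card κ := by
  simp [frobSq, Matrix.one_apply, apply_ite (fun z : ℂ => ‖z‖), ite_pow]

lemma abs_rtr_le_card_mul_norm {κ : Type*} [Fintype κ] [DecidableEq κ] (A : Matrix κ κ ℂ) :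
    |rtr A| ≤ Fintype.card κ + ‖A‖ ^ 2 * Fintype.card κ := by
  have h := abs_rtr_conjTranspose_mul_le (1 : Matrix κ κ ℂ) A one_pos
  rw [Matrix.conjTranspose_one, Matrix.one_mul, inv_one, one_mul, one_mul] at h
  have h2 := frobSq_mul_le_left A (1 : Matrix κ κ ℂ)
  rw [Matrix.mul_one, frobSq_one] at h2
  rw [frobSq_one] at h
  linarith

lemma HasAsympSymbol.integrable_rtr {X : ∀ n, SiteMatrix n d}
    {a : Torus → Matrix (Fin d) (Fin d) ℂ} (h : HasAsympSymbol X a) :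
    Integrable (fun x => rtr (a x)) μT := by
  obtain ⟨M, -, hM⟩ := h.bound
  refine Integrable.of_bound (continuous_rtr.comp_aestronglyMeasurable h.meas) (d + M ^ 2 * d) ?_
  filter_upwards [hM] with x hx
  have h1 := abs_rtr_le_card_mul_norm (a x)
  rw [Fintype.card_fin] at h1
  have h2 : ‖a x‖ ^ 2 * (d : ℝ) ≤ M ^ 2 * d := by gcongr
  rw [Real.norm_eq_abs]
  linarith

/-- Szegő's limit theorem: normalized traces converge to the average trace of the symbol. -/
theorem HasAsympSymbol.tendsto_rtr {X : ∀ n, SiteMatrix n d}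
    {a : Torus → Matrix (Fin d) (Fin d) ℂ} (h : HasAsympSymbol X a) :
    Tendsto (fun n : ℕ => 1 / (n : ℝ) * rtr (X n)) atTop (𝓝 (∫ x, rtr (a x) ∂μT)) := by
  have key : ∀ (n : ℕ) (η : ℝ), 0 < η → 0 < n →
      |1 / (n : ℝ) * rtr (X n) - ∫ x, rtr (a x) ∂μT|
        ≤ η * d + η⁻¹ * (1 / (n : ℝ) * ∫ x, frobSq (defect (X n) a x) ∂μT) := by
    intro n η hη hn
    have hn0 : (0 : ℝ) < n := by exact_mod_cast hn
    obtain ⟨h1, h2⟩ := integral_rtr_conjTranspose_wave_mul (X n)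
    have e1 : ∀ x, rtr ((wave n d x)ᴴ * defect (X n) a x)
        = rtr ((wave n d x)ᴴ * wave n d x * X n) - n * rtr (a x) := fun x => by
      rw [rtr, trace_conjTranspose_wave_mul_defect, rtr, rtr, Complex.sub_re]
      simp
    have e2 : rtr (X n) - n * ∫ x, rtr (a x) ∂μT
        = ∫ x, rtr ((wave n d x)ᴴ * defect (X n) a x) ∂μT := by
      simp only [e1]
      rw [integral_sub h1 (h.integrable_rtr.const_mul _), h2, integral_const_mul]
    have e3 : |rtr (X n) - n * ∫ x, rtr (a x) ∂μT|
        ≤ η * (n * d) + η⁻¹ * ∫ x, frobSq (defect (X n) a x) ∂μT := by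
      rw [e2]
      have hi : Integrable (fun x => η * (n * d : ℝ) + η⁻¹ * frobSq (defect (X n) a x)) μT :=
        (integrable_const _).add ((h.integrable n).const_mul _)
      have := norm_integral_le_of_norm_le hi (f := fun x => rtr ((wave n d x)ᴴ * defect (X n) a x))
        (Eventually.of_forall fun x => by
          have := abs_rtr_conjTranspose_mul_le (wave n d x) (defect (X n) a x) hη
          rwa [frobSq_wave] at this)
      rwa [integral_add (integrable_const _) ((h.integrable n).const_mul _), integral_const,
        probReal_univ, one_smul, integral_const_mul] at this
    calc _ = 1 / (n : ℝ) * |rtr (X n) - n * ∫ x, rtr (a x) ∂μT| := by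
          rw [← abs_of_pos (one_div_pos.mpr hn0), ← abs_mul, abs_of_pos (one_div_pos.mpr hn0)]
          congr 1
          field_simp
      _ ≤ 1 / (n : ℝ) * (η * (n * d) + η⁻¹ * ∫ x, frobSq (defect (X n) a x) ∂μT) :=
          mul_le_mul_of_nonneg_left e3 (by positivity)
      _ = _ := by field_simp
  refine Metric.tendsto_atTop.mpr fun δ hδ => ?_
  set η : ℝ := δ / (2 * (d + 1)) with hη_def
  have hη : 0 < η := by positivity
  have hηd : η * d < δ / 2 := by
    rw [hη_def, div_mul_eq_mul_div, div_lt_div_iff₀ (by positivity) (by norm_num)]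
    nlinarith
  obtain ⟨N, hN⟩ := Metric.tendsto_atTop.mp h.tendsto (η * (δ / 2)) (by positivity)
  refine ⟨N + 1, fun n hn => ?_⟩
  have h5 := hN n (by omega)
  rw [Real.dist_eq, sub_zero] at h5
  have h6 := mul_lt_mul_of_pos_left ((le_abs_self _).trans_lt h5) (inv_pos.mpr hη)
  rw [inv_mul_cancel_left₀ hη.ne'] at h6
  rw [Real.dist_eq]
  linarith [key n η hη (by omega)]

end Symbol

/-! ### Averages of Fourier truncation errors -/

section Truncation

variable {E : Type*} [NormedAddCommGroup E] [InnerProductSpace ℂ E]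

lemma norm_sum_repr_sub_sq_le (b : HilbertBasis ℤ ℂ E) (g : E) (A : Finset ℤ) :
    ‖∑ m ∈ A, b.repr g m • b m - g‖ ^ 2 ≤ (2 * ‖g‖) ^ 2 := by
  have h1 : ‖∑ m ∈ A, b.repr g m • b m‖ ^ 2 ≤ ‖g‖ ^ 2 := by
    have e : ‖∑ m ∈ A, b.repr g m • b m‖ ^ 2 = ∑ m ∈ A, ‖inner ℂ (b m) g‖ ^ 2 := by
      rw [← Complex.ofReal_inj]
      push_cast
      have := inner_self_eq_norm_sq_to_K (𝕜 := ℂ) (∑ m ∈ A, b.repr g m • b m)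
      rw [b.orthonormal.inner_sum] at this
      rw [← Complex.coe_algebraMap, ← this]
      refine Finset.sum_congr rfl fun m _ => ?_
      rw [b.repr_apply_apply, mul_comm, Complex.mul_conj, Complex.normSq_eq_norm_sq]
      simp
    rw [e]
    exact b.orthonormal.sum_inner_products_le g
  have h2 := le_of_sq_le_sq h1 (norm_nonneg _)
  refine pow_le_pow_left₀ (norm_nonneg _) ((norm_sub_le _ _).trans ?_) 2
  linarith

/-- The truncation errors of an orthonormal expansion to the windows `[-l, n-l)` vanish on
average over `l < n`: they are small unless `l` is close to `0` or `n`. -/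
lemma tendsto_average_truncation (b : HilbertBasis ℤ ℂ E) (g : E) :
    Tendsto (fun n : ℕ => 1 / (n : ℝ) * ∑ l ∈ Finset.range n,
      ‖∑ m ∈ Finset.Ico (-(l : ℤ)) (n - l), b.repr g m • b m - g‖ ^ 2) atTop (𝓝 0) := by
  set F : Finset ℤ → ℝ := fun A => ‖∑ m ∈ A, b.repr g m • b m - g‖ ^ 2 with hF
  set C : ℝ := (2 * ‖g‖) ^ 2 with hC
  have hF0 : ∀ A, 0 ≤ F A := fun A => sq_nonneg _
  have hFC : ∀ A, F A ≤ C := norm_sum_repr_sub_sq_le b g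
  have hC0 : 0 ≤ C := sq_nonneg _
  have hlim : Tendsto F atTop (𝓝 0) := by
    have h1 : Tendsto (fun A : Finset ℤ => ‖∑ m ∈ A, b.repr g m • b m - g‖) atTop (𝓝 0) :=
      tendsto_iff_norm_sub_tendsto_zero.mp (b.hasSum_repr g)
    simpa using h1.pow 2
  refine Metric.tendsto_atTop.mpr fun δ hδ => ?_
  obtain ⟨s, hs⟩ := (hlim.eventually_lt_const (half_pos hδ)).exists_forall_of_atTop
  obtain ⟨N, hN⟩ : ∃ N : ℕ, ∀ m ∈ s, -(N : ℤ) ≤ m ∧ m < N := by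
    refine ⟨s.sup (fun m => m.natAbs + 1), fun m hm => ?_⟩
    have := Finset.le_sup (f := fun m : ℤ => m.natAbs + 1) hm
    change m.natAbs + 1 ≤ _ at this
    omega
  have key : ∀ n : ℕ, ∀ l ∈ Finset.range n, F (Finset.Ico (-(l : ℤ)) (n - l))
      ≤ δ / 2 + ((if l < N then C else 0) + if n - l - 1 < N then C else 0) := by
    intro n l hl
    by_cases h1 : l < N
    · rw [if_pos h1]
      have : 0 ≤ if n - l - 1 < N then C else 0 := by split_ifs <;> simp [hC0]
      linarith [hFC (Finset.Ico (-(l : ℤ)) (n - l))]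
    · by_cases h2 : n - l - 1 < N
      · rw [if_pos h2, if_neg h1]
        linarith [hFC (Finset.Ico (-(l : ℤ)) (n - l))]
      · rw [if_neg h1, if_neg h2, add_zero, add_zero]
        refine (hs _ fun m hm => ?_).le
        have := hN m hm
        rw [Finset.mem_range] at hl
        rw [Finset.mem_Ico]
        omega
  have hcard : ∀ n : ℕ, ∑ l ∈ Finset.range n, (if l < N then C else 0) ≤ N * C := fun n => by
    rw [← Finset.sum_filter, Finset.sum_const, nsmul_eq_mul]
    refine mul_le_mul_of_nonneg_right ?_ hC0
    have : (Finset.range n).filter (· < N) ⊆ Finset.range N := fun l hl => by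
      rw [Finset.mem_filter] at hl
      exact Finset.mem_range.mpr hl.2
    exact_mod_cast (Finset.card_le_card this).trans_eq (Finset.card_range N)
  have hsum : ∀ n : ℕ, ∑ l ∈ Finset.range n, F (Finset.Ico (-(l : ℤ)) (n - l))
      ≤ n * (δ / 2) + 2 * (N * C) := fun n => by
    refine (Finset.sum_le_sum (key n)).trans ?_
    rw [Finset.sum_add_distrib, Finset.sum_add_distrib, Finset.sum_const, Finset.card_range,
      nsmul_eq_mul]
    have h3 : ∑ l ∈ Finset.range n, (if n - l - 1 < N then C else 0)
        = ∑ l ∈ Finset.range n, (if l < N then C else 0) := by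
      rw [← Finset.sum_range_reflect]
      refine Finset.sum_congr rfl fun l hl => ?_
      rw [Finset.mem_range] at hl
      have : n - (n - 1 - l) - 1 = l := by omega
      rw [this]
    rw [h3]
    linarith [hcard n]
  obtain ⟨K, hK⟩ := exists_nat_gt (2 * (N * C) / (δ / 2))
  refine ⟨K + 1, fun n hn => ?_⟩
  have hn0 : (0 : ℝ) < n := by exact_mod_cast (by omega : 0 < n)
  have hnK : (K : ℝ) < n := by exact_mod_cast (by omega : K < n)
  rw [Real.dist_eq, sub_zero, abs_of_nonneg (mul_nonneg (by positivity)
    (Finset.sum_nonneg fun l _ => hF0 _)), one_div, inv_mul_lt_iff₀ hn0]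
  have h4 := (div_lt_iff₀ (half_pos hδ)).mp (hK.trans hnK)
  linarith [hsum n]

lemma norm_sq_eq_integral (f : Lp ℂ 2 μT) : ‖f‖ ^ 2 = ∫ x, ‖f x‖ ^ 2 ∂μT := by
  have h := congrArg Complex.re (L2.inner_def (𝕜 := ℂ) f f)
  rw [← RCLike.re_eq_complex_re, ← integral_re (L2.integrable_inner f f)] at h
  simpa only [← norm_sq_eq_re_inner] using h

lemma integral_truncation {g : Torus → ℂ} (hg : MemLp g 2 μT) (A : Finset ℤ) :
    ∫ x, ‖∑ m ∈ A, fourierCoeff g m * (fourier m x : ℂ) - g x‖ ^ 2 ∂μT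
      = ‖∑ m ∈ A, (fourierBasis (T := 2 * Real.pi)).repr hg.toLp m • fourierBasis m
          - hg.toLp‖ ^ 2 := by
  rw [norm_sq_eq_integral]
  have hc : ∀ m, (fourierBasis (T := 2 * Real.pi)).repr hg.toLp m = fourierCoeff g m := fun m => by
    rw [fourierBasis_repr, fourierCoeff_congr_ae hg.coeFn_toLp]
  have hall : ∀ᵐ x ∂μT, ∀ m : ℤ, (fourierLp 2 m : Lp ℂ 2 μT) x = fourier m x :=
    ae_all_iff.mpr fun m => coeFn_fourierLp 2 m
  have hsm : ∀ᵐ x ∂μT, ∀ m : ℤ, (fourierCoeff g m • (fourierLp 2 m : Lp ℂ 2 μT) : Lp ℂ 2 μT) x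
      = fourierCoeff g m * (fourierLp 2 m : Lp ℂ 2 μT) x :=
    ae_all_iff.mpr fun m => Lp.coeFn_smul _ _
  simp only [hc, coe_fourierBasis]
  refine integral_congr_ae ?_
  filter_upwards [hg.coeFn_toLp, hall, hsm, Lp.coeFn_sub (∑ m ∈ A, fourierCoeff g m •
    (fourierLp 2 m : Lp ℂ 2 μT)) hg.toLp, Lp.coeFn_finsetSum A (fun m => fourierCoeff g m •
    (fourierLp 2 m : Lp ℂ 2 μT))] with x h1 h2 h3 h4 h5
  rw [h4, Pi.sub_apply, h5, h1, Finset.sum_apply]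
  simp only [h2, h3]

end Truncation

/-! ### Cut-offs of translation-invariant operators -/

section Cutoff

variable {d : ℕ}

lemma inner_siteVec (k : ℤ) (i : Fin d) (f : ChainSpace d) :
    inner ℂ (siteVec k i) f = (f i : ℤ → ℂ) k := by
  rw [PiLp.inner_apply, Finset.sum_eq_single i]
  · simp [siteVec, lp.inner_single_left]
  · intro j _ hj
    simp [siteVec, hj]
  · simp

lemma fourierL2_single (l : ℤ) :
    fourierL2 (lp.single 2 l (1 : ℂ)) = fourierLp 2 l := by
  rw [fourierL2, HilbertBasis.repr_symm_single, coe_fourierBasis]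

/-- The entries of the cut-offs are the Fourier coefficients of the symbol. -/
lemma cutoff_apply {Q : ChainSpace d →L[ℂ] ChainSpace d} {q : Torus → Matrix (Fin d) (Fin d) ℂ}
    (hQ : HasSymbol Q q) (n : ℕ) (k l : Fin n) (i j : Fin d) :
    cutoff Q n (toLex (k, i)) (toLex (l, j)) = fourierCoeff (fun x => q x i j) (k - l) := by
  have h1 : cutoff Q n (toLex (k, i)) (toLex (l, j))
      = ((Q (siteVec (l : ℤ) j)) i : ℤ → ℂ) k := inner_siteVec _ _ _
  have h2 : ∀ (f : lp (fun _ : ℤ => ℂ) 2) (m : ℤ), (f : ℤ → ℂ) m = fourierCoeff (fourierL2 f) m :=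
    fun f m => by rw [← fourierBasis_repr, fourierL2, LinearIsometryEquiv.apply_symm_apply]
  rw [h1, h2]
  refine integral_congr_ae ?_
  filter_upwards [hQ (siteVec (l : ℤ) j) i, coeFn_fourierLp (T := 2 * Real.pi) 2 (l : ℤ),
    Lp.coeFn_zero (E := ℂ) (p := 2) (μ := μT)] with x hx hx' hx0
  simp only [hx]
  rw [Finset.sum_eq_single j]
  · have : (siteVec (l : ℤ) j : ChainSpace d) j = lp.single 2 (l : ℤ) (1 : ℂ) := by simp [siteVec]
    rw [this, fourierL2_single, hx', neg_sub, sub_eq_add_neg, fourier_add, smul_eq_mul, smul_eq_mul]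
    ring
  · intro j' _ hj'
    have : (siteVec (l : ℤ) j : ChainSpace d) j' = 0 := by simp [siteVec, hj']
    rw [this, fourierL2, map_zero, hx0]
    simp
  · simp

lemma cutoff_eq_integral {Q : ChainSpace d →L[ℂ] ChainSpace d}
    {q : Torus → Matrix (Fin d) (Fin d) ℂ} (hQ : HasSymbol Q q) (n : ℕ) (b b' : Fin n ×ₗ Fin d) :
    cutoff Q n b b' = ∫ x, ((wave n d x)ᴴ * q x * wave n d x) b b' ∂μT := by
  obtain ⟨⟨k, i⟩, rfl⟩ := toLex.surjective b
  obtain ⟨⟨l, j⟩, rfl⟩ := toLex.surjective b'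
  rw [cutoff_apply hQ]
  refine integral_congr_ae (Eventually.of_forall fun x => ?_)
  simp only
  rw [Matrix.mul_apply, Finset.sum_eq_single j, Matrix.mul_apply, Finset.sum_eq_single i,
    Matrix.conjTranspose_apply, wave_toLex, wave_toLex, if_pos rfl, if_pos rfl, neg_sub,
    sub_eq_add_neg, fourier_add, fourier_neg, smul_eq_mul]
  · rw [← starRingEnd_apply]; ring
  · intro i' _ hi'
    rw [Matrix.conjTranspose_apply, wave_toLex, if_neg hi', star_zero, zero_mul]
  · simp
  · intro j' _ hj'
    rw [wave_toLex, if_neg hj', mul_zero]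
  · simp

lemma integrable_wave_conj {n : ℕ} {B : Torus → Matrix (Fin d) (Fin d) ℂ}
    (hi : ∀ i j, Integrable (fun x => B x i j) μT) (b b' : Fin n ×ₗ Fin d) :
    Integrable (fun x => ((wave n d x)ᴴ * B x * wave n d x) b b') μT := by
  simp only [Matrix.mul_apply, Finset.sum_mul]
  refine integrable_finsetSum _ fun j _ => integrable_finsetSum _ fun i _ => ?_
  have hw : ∀ (i : Fin d) (b : Fin n ×ₗ Fin d), Continuous fun x => wave n d x i b :=
    fun i b => (continuous_wave n d).matrix_elem i b
  have hw1 : ∀ (i : Fin d) (b : Fin n ×ₗ Fin d) (x : Torus), ‖wave n d x i b‖ ≤ 1 :=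
    fun i b x => by
      rw [wave, Matrix.of_apply]
      split_ifs
      · rw [norm_fourier_apply]
      · simp
  refine Integrable.mul_bdd (c := 1) ((hi i j).bdd_mul (c := 1) ?_ ?_) ?_ ?_
  · exact (hw i b).star.aestronglyMeasurable
  · exact Eventually.of_forall fun x => by
      rw [Matrix.conjTranspose_apply, norm_star]; exact hw1 _ _ _
  · exact (hw j b').aestronglyMeasurable
  · exact Eventually.of_forall fun x => hw1 _ _ _

/-- Compressions of multiplication by a positive function are positive. -/
lemma posSemidef_integral_wave {n : ℕ} {B : Torus → Matrix (Fin d) (Fin d) ℂ}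
    (hi : ∀ i j, Integrable (fun x => B x i j) μT) (hB : ∀ᵐ x ∂μT, (B x).PosSemidef)
    {M : SiteMatrix n d}
    (hM : ∀ b b', M b b' = ∫ x, ((wave n d x)ᴴ * B x * wave n d x) b b' ∂μT) :
    M.PosSemidef := by
  have hI := integrable_wave_conj (n := n) hi
  have hq : ∀ᵐ x ∂μT, ((wave n d x)ᴴ * B x * wave n d x).PosSemidef := by
    filter_upwards [hB] with x hx using hx.conjTranspose_mul_mul_same _
  refine Matrix.PosSemidef.of_dotProduct_mulVec_nonneg ?_ fun v => ?_
  · ext b b'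
    rw [Matrix.conjTranspose_apply, hM, hM, ← starRingEnd_apply, ← integral_conj]
    refine integral_congr_ae ?_
    filter_upwards [hq] with x hx
    rw [starRingEnd_apply, hx.isHermitian.apply]
  · have e : star v ⬝ᵥ (M *ᵥ v)
        = ∫ x, star v ⬝ᵥ (((wave n d x)ᴴ * B x * wave n d x) *ᵥ v) ∂μT := by
      simp only [dotProduct, Matrix.mulVec, Finset.mul_sum]
      rw [integral_finsetSum _ fun b _ => integrable_finsetSum _ fun b' _ =>
        ((hI b b').mul_const _).const_mul _]
      refine Finset.sum_congr rfl fun b _ => ?_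
      rw [integral_finsetSum _ fun b' _ => ((hI b b').mul_const _).const_mul _]
      refine Finset.sum_congr rfl fun b' _ => ?_
      rw [integral_const_mul, integral_mul_const, hM]
    rw [e]
    refine integral_nonneg_of_ae ?_
    filter_upwards [hq] with x hx using hx.dotProduct_mulVec_nonneg v

section Order
open scoped MatrixOrder

lemma specIn_Icc_iff {κ : Type*} [Fintype κ] [DecidableEq κ] {l u : ℝ} {A : Matrix κ κ ℂ} :
    SpecIn (Set.Icc l u) A ↔ (A - l • (1 : Matrix κ κ ℂ)).PosSemidef ∧
      (u • (1 : Matrix κ κ ℂ) - A).PosSemidef := by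
  have key : ∀ hA : A.IsHermitian, spectrum ℝ A ⊆ Set.Icc l u ↔
      (A - l • (1 : Matrix κ κ ℂ)).PosSemidef ∧ (u • (1 : Matrix κ κ ℂ) - A).PosSemidef := by
    intro hA
    rw [← Matrix.le_iff, ← Matrix.le_iff, ← Algebra.algebraMap_eq_smul_one,
      ← Algebra.algebraMap_eq_smul_one, algebraMap_le_iff_le_spectrum hA.isSelfAdjoint,
      le_algebraMap_iff_spectrum_le hA.isSelfAdjoint]
    exact ⟨fun h => ⟨fun t ht => (h ht).1, fun t ht => (h ht).2⟩,
      fun h t ht => ⟨h.1 t ht, h.2 t ht⟩⟩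
  refine ⟨fun h => (key h.1).mp h.2, fun h => ?_⟩
  have hA : A.IsHermitian := by
    have := h.1.isHermitian.add (isHermitian_smul_real (Matrix.isHermitian_one (n := κ) (α := ℂ)) l)
    rwa [sub_add_cancel] at this
  exact ⟨hA, (key hA).mpr h⟩

end Order

section Norm
open scoped Matrix.Norms.L2Operator

lemma SpecIn.norm_le {κ : Type*} [Fintype κ] [DecidableEq κ] {l u : ℝ} {A : Matrix κ κ ℂ}
    (h : SpecIn (Set.Icc l u) A) : ‖A‖ ≤ max |l| |u| := by
  rw [← cfc_id_fun h.1]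
  exact norm_cfc_le (le_max_of_le_left (abs_nonneg l)) fun t ht =>
    abs_le_max_abs_abs (h.2 ht).1 (h.2 ht).2

lemma norm_apply_sq_le {κ : Type*} [Fintype κ] [DecidableEq κ] (A : Matrix κ κ ℂ) (i j : κ) :
    ‖A i j‖ ^ 2 ≤ ‖A‖ ^ 2 * Fintype.card κ := by
  have h := frobSq_mul_le_left A (1 : Matrix κ κ ℂ)
  rw [Matrix.mul_one, frobSq_one] at h
  refine le_trans ?_ h
  exact (Finset.single_le_sum (f := fun j => ‖A i j‖ ^ 2) (fun _ _ => sq_nonneg _)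
    (Finset.mem_univ j)).trans (Finset.single_le_sum (f := fun i => ∑ j, ‖A i j‖ ^ 2)
    (fun _ _ => Finset.sum_nonneg fun _ _ => sq_nonneg _) (Finset.mem_univ i))

lemma memLp_apply_of_specIn {a : Torus → Matrix (Fin d) (Fin d) ℂ}
    (ha : AEStronglyMeasurable a μT) {l u : ℝ} (h : ∀ᵐ x ∂μT, SpecIn (Set.Icc l u) (a x))
    (i j : Fin d) : MemLp (fun x => a x i j) 2 μT := by
  refine MemLp.of_bound ((continuous_id.matrix_elem i j).comp_aestronglyMeasurable ha)
    (Real.sqrt (max |l| |u| ^ 2 * d)) ?_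
  filter_upwards [h] with x hx
  refine Real.le_sqrt_of_sq_le ((norm_apply_sq_le _ i j).trans ?_)
  rw [Fintype.card_fin]
  have := hx.norm_le
  gcongr

lemma SpecIn.cutoff {Q : ChainSpace d →L[ℂ] ChainSpace d} {q : Torus → Matrix (Fin d) (Fin d) ℂ}
    (hQ : HasSymbol Q q) (hm : AEStronglyMeasurable q μT) {l u : ℝ}
    (hq : ∀ᵐ x ∂μT, SpecIn (Set.Icc l u) (q x)) (n : ℕ) :
    SpecIn (Set.Icc l u) (cutoff Q n) := by
  have hqi : ∀ i j, Integrable (fun x => q x i j) μT := fun i j =>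
    (memLp_apply_of_specIn hm hq i j).integrable (by norm_num)
  have hone : ∀ (r : ℝ) (i j : Fin d),
      Integrable (fun _ : Torus => (r • (1 : Matrix (Fin d) (Fin d) ℂ)) i j) μT :=
    fun r i j => integrable_const _
  have hint : ∀ (r : ℝ) (b b' : Fin n ×ₗ Fin d), (r • (1 : SiteMatrix n d)) b b'
      = ∫ x, ((wave n d x)ᴴ * (r • (1 : Matrix (Fin d) (Fin d) ℂ)) * wave n d x) b b' ∂μT :=
    fun r b b' => by
      simp only [Matrix.mul_smul, Matrix.smul_mul, Matrix.mul_one, Matrix.smul_apply]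
      rw [integral_smul, integral_conjTranspose_wave_mul]
  refine specIn_Icc_iff.mpr ⟨?_, ?_⟩
  · refine posSemidef_integral_wave (B := fun x => q x - l • (1 : Matrix (Fin d) (Fin d) ℂ))
      (fun i j => (hqi i j).sub (hone l i j)) ?_ fun b b' => ?_
    · filter_upwards [hq] with x hx using (specIn_Icc_iff.mp hx).1
    · simp only [Matrix.mul_sub, Matrix.sub_mul, Matrix.sub_apply]
      rw [integral_sub (integrable_wave_conj hqi b b') (integrable_wave_conj (hone l) b b'),
        ← cutoff_eq_integral hQ, ← hint]
  · refine posSemidef_integral_wave (B := fun x => u • (1 : Matrix (Fin d) (Fin d) ℂ) - q x)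
      (fun i j => (hone u i j).sub (hqi i j)) ?_ fun b b' => ?_
    · filter_upwards [hq] with x hx using (specIn_Icc_iff.mp hx).2
    · simp only [Matrix.mul_sub, Matrix.sub_mul, Matrix.sub_apply]
      rw [integral_sub (integrable_wave_conj (hone u) b b') (integrable_wave_conj hqi b b'),
        ← cutoff_eq_integral hQ, ← hint]

lemma sum_fin_sub_eq_sum_Ico {M : Type*} [AddCommMonoid M] (n l : ℕ) (f : ℤ → M) :
    ∑ k : Fin n, f ((k : ℕ) - (l : ℤ)) = ∑ m ∈ Finset.Ico (-(l : ℤ)) (n - l), f m := by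
  rw [Fin.sum_univ_eq_sum_range (fun k : ℕ => f ((k : ℤ) - l))]
  refine Finset.sum_nbij' (fun k : ℕ => (k : ℤ) - l) (fun m => (m + l).toNat) ?_ ?_ ?_ ?_ ?_
  · intro k hk; simp only [Finset.mem_range, Finset.mem_Ico] at *; omega
  · intro m hm; simp only [Finset.mem_range, Finset.mem_Ico] at *; omega
  · intro k hk; simp
  · intro m hm; simp only [Finset.mem_Ico] at hm; omega
  · intro k hk; rfl

lemma norm_defect_cutoff {Q : ChainSpace d →L[ℂ] ChainSpace d}
    {q : Torus → Matrix (Fin d) (Fin d) ℂ} (hQ : HasSymbol Q q) (n : ℕ) (l : Fin n) (i j : Fin d)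
    (x : Torus) : ‖defect (cutoff Q n) q x i (toLex (l, j))‖
      = ‖∑ m ∈ Finset.Ico (-((l : ℕ) : ℤ)) (n - ((l : ℕ) : ℤ)),
          fourierCoeff (fun x => q x i j) m * (fourier m x : ℂ) - q x i j‖ := by
  have h1 : (wave n d x * cutoff Q n) i (toLex (l, j))
      = ∑ k : Fin n, (fourier (k : ℤ) x : ℂ) * fourierCoeff (fun x => q x i j) (k - l) := by
    rw [Matrix.mul_apply, sum_site]
    refine Finset.sum_congr rfl fun k _ => ?_
    rw [Finset.sum_eq_single i, wave_toLex, if_pos rfl, cutoff_apply hQ]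
    · intro m _ hm
      rw [wave_toLex, if_neg hm.symm, zero_mul]
    · simp
  have h2 : (q x * wave n d x) i (toLex (l, j)) = q x i j * (fourier (l : ℤ) x : ℂ) := by
    rw [Matrix.mul_apply, Finset.sum_eq_single j, wave_toLex, if_pos rfl]
    · intro m _ hm
      rw [wave_toLex, if_neg hm, mul_zero]
    · simp
  have h3 : ∀ k : ℤ, (fourier k x : ℂ)
      = (fourier (l : ℤ) x : ℂ) * (fourier (k - (l : ℤ)) x : ℂ) := fun k => by
    rw [← fourier_add, add_sub_cancel]
  rw [defect, Matrix.sub_apply, h1, h2, ← sum_fin_sub_eq_sum_Ico n l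
    (fun m => fourierCoeff (fun x => q x i j) m * (fourier m x : ℂ))]
  have h4 : ∑ k : Fin n, (fourier (k : ℤ) x : ℂ) * fourierCoeff (fun x => q x i j) (k - l)
        - q x i j * (fourier (l : ℤ) x : ℂ)
      = (fourier (l : ℤ) x : ℂ) * (∑ k : Fin n, fourierCoeff (fun x => q x i j) (k - l)
          * (fourier ((k : ℤ) - l) x : ℂ) - q x i j) := by
    rw [mul_sub, Finset.mul_sum, mul_comm (q x i j)]
    congr 1
    refine Finset.sum_congr rfl fun k _ => ?_
    rw [h3 k]; ring
  rw [h4, norm_mul, norm_fourier_apply, one_mul]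

/-- The cut-offs of a translation-invariant operator have its symbol as asymptotic symbol. -/
theorem hasAsympSymbol_cutoff {Q : ChainSpace d →L[ℂ] ChainSpace d}
    {q : Torus → Matrix (Fin d) (Fin d) ℂ} (hQ : HasSymbol Q q) (hm : AEStronglyMeasurable q μT)
    {l u : ℝ} (hq : ∀ᵐ x ∂μT, SpecIn (Set.Icc l u) (q x)) :
    HasAsympSymbol (fun n => cutoff Q n) q where
  meas := hm
  bound := ⟨max |l| |u|, fun n => (SpecIn.cutoff hQ hm hq n).norm_le, by
    filter_upwards [hq] with x hx using hx.norm_le⟩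
  tendsto := by
    have hL := memLp_apply_of_specIn hm hq
    have h1 : Tendsto (fun n : ℕ => ∑ i : Fin d, ∑ j : Fin d, 1 / (n : ℝ) * ∑ l ∈ Finset.range n,
        ‖∑ m ∈ Finset.Ico (-(l : ℤ)) (n - l),
          (fourierBasis (T := 2 * Real.pi)).repr (hL i j).toLp m • fourierBasis m
            - (hL i j).toLp‖ ^ 2) atTop (𝓝 (∑ i : Fin d, ∑ j : Fin d, 0)) :=
      tendsto_finsetSum _ fun i _ => tendsto_finsetSum _ fun j _ =>
        tendsto_average_truncation _ _
    simp only [Finset.sum_const_zero] at h1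
    refine h1.congr fun n => ?_
    have hi : ∀ (i j : Fin d) (l : Fin n),
        Integrable (fun x => ‖defect (cutoff Q n) q x i (toLex (l, j))‖ ^ 2) μT := by
      intro i j l
      simp only [norm_defect_cutoff hQ]
      refine MemLp.integrable_norm_pow (p := 2) (MemLp.sub ?_ (hL i j)) (by norm_num)
      refine memLp_finsetSum _ fun m _ => ?_
      exact (MemLp.of_bound (fourier m).continuous.aestronglyMeasurable 1
        (Eventually.of_forall fun x => (norm_fourier_apply m x).le)).const_mul _
    simp only [frobSq, sum_site]
    rw [integral_finsetSum _ fun i _ => integrable_finsetSum _ fun l _ =>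
      integrable_finsetSum _ fun j _ => hi i j l, Finset.mul_sum]
    refine Finset.sum_congr rfl fun i _ => ?_
    rw [integral_finsetSum _ fun l _ => integrable_finsetSum _ fun j _ => hi i j l,
      ← Finset.mul_sum, Finset.sum_comm]
    congr 1
    rw [← Fin.sum_univ_eq_sum_range (fun l : ℕ => ∑ j : Fin d,
      ‖∑ m ∈ Finset.Ico (-(l : ℤ)) (n - l),
          (fourierBasis (T := 2 * Real.pi)).repr (hL i j).toLp m • fourierBasis m
            - (hL i j).toLp‖ ^ 2)]
    refine Finset.sum_congr rfl fun l _ => ?_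
    rw [integral_finsetSum _ fun j _ => hi i j l]
    refine Finset.sum_congr rfl fun j _ => ?_
    simp only [norm_defect_cutoff hQ]
    exact (integral_truncation (hL i j) _).symm

end Norm

end Cutoff

/-! ### Rényi quantities of asymptotic symbols -/

section AsympOn

open scoped Matrix.Norms.L2Operator

variable {d : ℕ}

section Order
open scoped MatrixOrder

lemma SpecIn.mul_mul {κ : Type*} [Fintype κ] [DecidableEq κ] {l u l' u' : ℝ}
    {A B : Matrix κ κ ℂ} (hl : 0 < l) (hl' : 0 < l') (hA : SpecIn (Set.Icc l u) A)
    (hB : SpecIn (Set.Icc l' u') B) :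
    SpecIn (Set.Icc (l' * l ^ 2) (u' * u ^ 2)) (A * B * A) := by
  have hsa : star A = A := hA.1
  have hAA : A * A = cfc (fun t : ℝ => t ^ 2) A := by
    conv_lhs => rw [← cfc_id_fun hA.1, ← cfc_mul_fun]
    simp only [pow_two]
  have hc : ∀ r : ℝ, A * (r • (1 : Matrix κ κ ℂ)) * A =
      cfc (fun t : ℝ => r * t ^ 2) A := fun r => by
    rw [Matrix.mul_smul, Matrix.smul_mul, mul_one, hAA, ← cfc_smul_fun]
  obtain ⟨h1, h2⟩ := specIn_Icc_iff.mp hB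
  refine specIn_Icc_iff.mpr ⟨?_, ?_⟩ <;> rw [← Matrix.le_iff] at *
  · have h3 := star_left_conjugate_le_conjugate h1 A
    rw [hsa, hc] at h3
    refine le_trans ?_ h3
    rw [← Algebra.algebraMap_eq_smul_one]
    refine algebraMap_le_cfc _ _ A (fun t ht => ?_) (continuousOn_spectrum _ A) hA.1.isSelfAdjoint
    have := (hA.2 ht).1
    gcongr
  · have h3 := star_left_conjugate_le_conjugate h2 A
    rw [hsa, hc] at h3
    refine h3.trans ?_
    rw [← Algebra.algebraMap_eq_smul_one]
    refine cfc_le_algebraMap _ _ A (fun t ht => ?_) (continuousOn_spectrum _ A) hA.1.isSelfAdjoint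
    have h5 := hA.2 ht
    have h4 : 0 ≤ t := hl.le.trans h5.1
    have h6 := h5.2
    by_cases hu : 0 ≤ u'
    · gcongr
    · -- the bounds on `B` are contradictory unless the index type is empty
      exfalso
      have hne : (spectrum ℝ B).Nonempty := by
        have : Nonempty κ := by
          by_contra hκ
          rw [not_nonempty_iff] at hκ
          exact absurd ht (by simp [spectrum.of_subsingleton])
        exact ⟨_, hB.1.eigenvalues_mem_spectrum_real (Classical.arbitrary κ)⟩
      obtain ⟨s, hs⟩ := hne
      have := hB.2 hs
      linarith [this.1, this.2]

end Order

/-- The matrices `X n` have asymptotic symbol `a`, are Hermitian along with `a`, and all their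
spectra lie in a common compact interval inside `U`. -/
def AsympOn (U : Set ℝ) (X : ∀ n, SiteMatrix n d) (a : Torus → Matrix (Fin d) (Fin d) ℂ) : Prop :=
  ∃ l u : ℝ, Set.Icc l u ⊆ U ∧ HasAsympSymbol X a ∧ (∀ n, SpecIn (Set.Icc l u) (X n)) ∧
    ∀ᵐ x ∂μT, SpecIn (Set.Icc l u) (a x)

namespace AsympOn

variable {U V : Set ℝ} {X Y : ∀ n, SiteMatrix n d} {a b : Torus → Matrix (Fin d) (Fin d) ℂ}

lemma hasAsympSymbol (h : AsympOn U X a) : HasAsympSymbol X a := by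
  obtain ⟨l, u, -, h, -⟩ := h
  exact h

lemma specIn (h : AsympOn U X a) : (∀ n, SpecIn U (X n)) ∧ ∀ᵐ x ∂μT, SpecIn U (a x) := by
  obtain ⟨l, u, hU, -, h1, h2⟩ := h
  refine ⟨fun n => ⟨(h1 n).1, (h1 n).2.trans hU⟩, ?_⟩
  filter_upwards [h2] with x hx using ⟨hx.1, hx.2.trans hU⟩

lemma isHermitian (h : AsympOn U X a) :
    (∀ n, (X n).IsHermitian) ∧ ∀ᵐ x ∂μT, (a x).IsHermitian := by
  refine ⟨fun n => (h.specIn.1 n).1, ?_⟩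
  filter_upwards [h.specIn.2] with x hx using hx.1

lemma congr (h : AsympOn U X a) (h1 : ∀ n, Y n = X n) (h2 : ∀ᵐ x ∂μT, b x = a x) :
    AsympOn U Y b := by
  obtain ⟨l, u, hU, h, h3, h4⟩ := h
  refine ⟨l, u, hU, h.congr h1 h2, fun n => h1 n ▸ h3 n, ?_⟩
  filter_upwards [h2, h4] with x hx hx'
  rwa [hx]

lemma functionalCalculus (h : AsympOn U X a) {f : ℝ → ℝ} (hf : ContinuousOn f U)
    (hV : Set.MapsTo f U V) : AsympOn V (fun n => cfc f (X n)) fun x => cfc f (a x) := by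
  obtain ⟨l, u, hU, h, h1, h2⟩ := h
  have hf' := hf.mono hU
  have hV' : f '' Set.Icc l u ⊆ V := Set.image_subset_iff.mpr fun t ht => hV (hU ht)
  obtain ⟨l', u', himg⟩ : ∃ l' u', f '' Set.Icc l u = Set.Icc l' u' := by
    rcases le_or_gt l u with hlu | hlu
    · exact ⟨_, _, hf'.image_Icc hlu⟩
    · exact ⟨1, 0, by simp [hlu.not_ge]⟩
  have key : ∀ {κ : Type} [Fintype κ] [DecidableEq κ] {A : Matrix κ κ ℂ},
      SpecIn (Set.Icc l u) A → SpecIn (Set.Icc l' u') (cfc f A) := fun hA =>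
    ⟨isHermitian_cfc _ _, by rw [spectrum_cfc _ hA.1, ← himg]; exact Set.image_mono hA.2⟩
  refine ⟨l', u', himg ▸ hV', h.functionalCalculus h1 h2 hf', fun n => key (h1 n), ?_⟩
  filter_upwards [h2] with x hx using key hx

lemma of_hasAsympSymbol (h : HasAsympSymbol X a) (h1 : ∀ n, (X n).IsHermitian)
    (h2 : ∀ᵐ x ∂μT, (a x).IsHermitian) : AsympOn Set.univ X a := by
  obtain ⟨M, h3, h4⟩ := h.bound
  have key : ∀ {κ : Type} [Fintype κ] [DecidableEq κ] {A : Matrix κ κ ℂ}, A.IsHermitian →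
      ‖A‖ ≤ M → SpecIn (Set.Icc (-M) M) A := fun {κ _ _ A} hA hM => ⟨hA, fun t ht => by
    have : |t| ≤ M := by
      refine le_trans ?_ hM
      have := norm_apply_le_norm_cfc (fun t : ℝ => t) A ht (continuousOn_spectrum _ A)
        hA.isSelfAdjoint
      rwa [cfc_id_fun hA] at this
    exact abs_le.mp this⟩
  refine ⟨-M, M, Set.subset_univ _, h, fun n => key (h1 n) (h3 n), ?_⟩
  filter_upwards [h2, h4] with x hx hx' using key hx hx'

lemma add (hX : AsympOn Set.univ X a) (hY : AsympOn Set.univ Y b) :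
    AsympOn Set.univ (fun n => X n + Y n) fun x => a x + b x :=
  of_hasAsympSymbol (hX.hasAsympSymbol.add hY.hasAsympSymbol)
    (fun n => (hX.isHermitian.1 n).add (hY.isHermitian.1 n)) (by
      filter_upwards [hX.isHermitian.2, hY.isHermitian.2] with x h1 h2 using h1.add h2)

lemma smul (hX : AsympOn Set.univ X a) (r : ℝ) :
    AsympOn Set.univ (fun n => r • X n) fun x => r • a x :=
  of_hasAsympSymbol (hX.hasAsympSymbol.smul r)
    (fun n => isHermitian_smul_real (hX.isHermitian.1 n) r) (by
      filter_upwards [hX.isHermitian.2] with x h using isHermitian_smul_real h r)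

lemma mul_mul (hX : AsympOn (Set.Ioi 0) X a) (hY : AsympOn (Set.Ioi 0) Y b) :
    AsympOn (Set.Ioi 0) (fun n => X n * Y n * X n) fun x => a x * b x * a x := by
  have hX0 := hX.hasAsympSymbol
  have hY0 := hY.hasAsympSymbol
  obtain ⟨l, u, hU, -, h1, h2⟩ := hX
  obtain ⟨l', u', hU', -, h1', h2'⟩ := hY
  -- enlarge the intervals so that they are not empty
  have hne : ∀ {l u : ℝ}, Set.Icc l u ⊆ Set.Ioi 0 → ∃ l₁, 0 < l₁ ∧ Set.Icc l u ⊆ Set.Icc l₁ u :=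
    fun {l u} h => by
      rcases le_or_gt l u with hlu | hlu
      · exact ⟨l, h ⟨le_rfl, hlu⟩, subset_rfl⟩
      · exact ⟨1, one_pos, by simp [hlu.not_ge]⟩
  obtain ⟨l₁, hl, hlu⟩ := hne hU
  obtain ⟨l₁', hl', hlu'⟩ := hne hU'
  have key : ∀ {κ : Type} [Fintype κ] [DecidableEq κ] {A B : Matrix κ κ ℂ},
      SpecIn (Set.Icc l u) A → SpecIn (Set.Icc l' u') B →
      SpecIn (Set.Icc (l₁' * l₁ ^ 2) (u' * u ^ 2)) (A * B * A) := fun hA hB =>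
    SpecIn.mul_mul hl hl' ⟨hA.1, hA.2.trans hlu⟩ ⟨hB.1, hB.2.trans hlu'⟩
  refine ⟨l₁' * l₁ ^ 2, u' * u ^ 2, fun t ht => lt_of_lt_of_le (by positivity) ht.1,
    (hX0.mul hY0).mul hX0, fun n => key (h1 n) (h1' n), ?_⟩
  filter_upwards [h2, h2'] with x hx hx' using key hx hx'

lemma mpow (h : AsympOn (Set.Ioi 0) X a) (p : ℝ) :
    AsympOn (Set.Ioi 0) (fun n => mpow (X n) p) fun x => FermiChain.mpow (a x) p :=
  h.functionalCalculus (fun t ht => (Real.continuousAt_rpow_const t p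
    (Or.inl (ne_of_gt ht))).continuousWithinAt) fun _ ht => Real.rpow_pos_of_pos ht p

lemma mlog (h : AsympOn (Set.Ioi 0) X a) :
    AsympOn Set.univ (fun n => mlog (X n)) fun x => FermiChain.mlog (a x) :=
  h.functionalCalculus (Real.continuousOn_log.mono fun _ ht => ne_of_gt ht)
    (Set.mapsTo_univ _ _)

lemma mexp (h : AsympOn Set.univ X a) :
    AsympOn (Set.Ioi 0) (fun n => mexp (X n)) fun x => FermiChain.mexp (a x) :=
  h.functionalCalculus Real.continuous_exp.continuousOn fun t _ => Real.exp_pos t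

lemma renyiOp (hX : AsympOn (Set.Ioi 0) X a) (hY : AsympOn (Set.Ioi 0) Y b) (α : ℝ)
    (γ : RenyiIndex) :
    AsympOn (Set.Ioi 0) (fun n => renyiOp α γ (X n) (Y n))
      fun x => FermiChain.renyiOp α γ (a x) (b x) := by
  cases γ with
  | finite z hz => exact ((hX.mpow _).mul_mul (hY.mpow _)).mpow z
  | infinity => exact ((hX.mlog.smul α).add (hY.mlog.smul (1 - α))).mexp
  | maximal => exact (hY.mpow _).mul_mul (((hY.mpow _).mul_mul hX).mpow α)

lemma one_sub (h : AsympOn (Set.Ioo 0 1) X a) :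
    AsympOn (Set.Ioi 0) (fun n => 1 - X n) fun x => 1 - a x := by
  refine (h.functionalCalculus (f := fun t => 1 - t) (V := Set.Ioi 0) (by fun_prop)
    fun t ht => sub_pos.mpr ht.2).congr (fun n => one_sub_eq_cfc (h.isHermitian.1 n)) ?_
  filter_upwards [h.isHermitian.2] with x hx using one_sub_eq_cfc hx

lemma one_add (h : AsympOn (Set.Ioi 0) X a) :
    AsympOn (Set.Ioi 0) (fun n => 1 + X n) fun x => 1 + a x := by
  refine (h.functionalCalculus (f := fun t => 1 + t) (V := Set.Ioi 0) (by fun_prop)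
    fun _ ht => add_pos one_pos (Set.mem_Ioi.mp ht)).congr
      (fun n => one_add_eq_cfc (h.isHermitian.1 n)) ?_
  filter_upwards [h.isHermitian.2] with x hx using one_add_eq_cfc hx

lemma inv (h : AsympOn (Set.Ioi 0) X a) :
    AsympOn (Set.Ioi 0) (fun n => (X n)⁻¹) fun x => (a x)⁻¹ := by
  have key : ∀ {κ : Type} [Fintype κ] [DecidableEq κ] {A : Matrix κ κ ℂ},
      SpecIn (Set.Ioi 0) A → A⁻¹ = cfc (fun t : ℝ => t⁻¹) A := fun hA => by
    rw [← cfc_nonsing_inv _ hA.1 fun t ht => ne_of_gt (hA.2 ht), cfc_id_fun hA.1]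
  refine (h.functionalCalculus (f := fun t => t⁻¹) (V := Set.Ioi 0)
    (continuousOn_inv₀.mono fun t ht => ne_of_gt ht)
    fun _ ht => inv_pos.mpr (Set.mem_Ioi.mp ht)).congr (fun n => key (h.specIn.1 n)) ?_
  filter_upwards [h.specIn.2] with x hx using key hx

lemma weight (h : AsympOn (Set.Ioo 0 1) X a) :
    AsympOn (Set.Ioi 0) (fun n => weight (X n)) fun x => FermiChain.weight (a x) := by
  refine (h.functionalCalculus (f := fun t => t * (1 - t)⁻¹) (V := Set.Ioi 0) ?_
    fun t ht => mul_pos ht.1 (inv_pos.mpr (sub_pos.mpr ht.2))).congr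
    (fun n => weight_eq_cfc (h.specIn.1 n).1 (h.specIn.1 n).2) ?_
  · exact continuousOn_id.mul ((continuousOn_const.sub continuousOn_id).inv₀
      fun t ht => (sub_pos.mpr ht.2).ne')
  · filter_upwards [h.specIn.2] with x hx using weight_eq_cfc hx.1 hx.2

lemma pos (h : AsympOn (Set.Ioo 0 1) X a) : AsympOn (Set.Ioi 0) X a := by
  obtain ⟨l, u, hU, h'⟩ := h
  exact ⟨l, u, fun t ht => (hU ht).1, h'⟩

end AsympOn

/-- Normalized values along `X n` converge to the average of an integrable function. -/
def ConvergesToAverage (F : ℕ → ℝ) (f : Torus → ℝ) : Prop :=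
  Integrable f μT ∧ Tendsto (fun n : ℕ => 1 / (n : ℝ) * F n) atTop (𝓝 (∫ x, f x ∂μT))

lemma HasAsympSymbol.convergesToAverage {X : ∀ n, SiteMatrix n d}
    {a : Torus → Matrix (Fin d) (Fin d) ℂ} (h : HasAsympSymbol X a) :
    ConvergesToAverage (fun n => rtr (X n)) fun x => rtr (a x) :=
  ⟨h.integrable_rtr, h.tendsto_rtr⟩

lemma ConvergesToAverage.add {F G : ℕ → ℝ} {f g : Torus → ℝ} (hF : ConvergesToAverage F f)
    (hG : ConvergesToAverage G g) : ConvergesToAverage (fun n => F n + G n) fun x => f x + g x := by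
  refine ⟨hF.1.add hG.1, ?_⟩
  rw [integral_add hF.1 hG.1]
  simpa only [mul_add] using hF.2.add hG.2

lemma ConvergesToAverage.const_mul {F : ℕ → ℝ} {f : Torus → ℝ} (hF : ConvergesToAverage F f)
    (r : ℝ) : ConvergesToAverage (fun n => r * F n) fun x => r * f x := by
  refine ⟨hF.1.const_mul r, ?_⟩
  rw [integral_const_mul]
  simpa only [mul_left_comm r] using hF.2.const_mul r

variable {X Y : ∀ n, SiteMatrix n d} {a b : Torus → Matrix (Fin d) (Fin d) ℂ}

lemma convergesToAverage_psiQf (hX : AsympOn (Set.Ioo 0 1) X a) (hY : AsympOn (Set.Ioo 0 1) Y b)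
    (α : ℝ) (γ : RenyiIndex) :
    ConvergesToAverage (fun n => psiQf α γ (X n) (Y n)) fun x => psiQf α γ (a x) (b x) :=
  ((hX.one_sub.mlog.hasAsympSymbol.convergesToAverage.const_mul α).add
    (hY.one_sub.mlog.hasAsympSymbol.convergesToAverage.const_mul (1 - α))).add
    (hX.weight.renyiOp hY.weight α γ).one_add.mlog.hasAsympSymbol.convergesToAverage

lemma convergesToAverage_umegakiQf (hX : AsympOn (Set.Ioo 0 1) X a)
    (hY : AsympOn (Set.Ioo 0 1) Y b) :
    ConvergesToAverage (fun n => umegakiQf (X n) (Y n)) fun x => umegakiQf (a x) (b x) :=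
  ((hX.hasAsympSymbol.mul (hX.pos.mlog.hasAsympSymbol.sub hY.pos.mlog.hasAsympSymbol)).add
    (hX.one_sub.hasAsympSymbol.mul (hX.one_sub.mlog.hasAsympSymbol.sub
      hY.one_sub.mlog.hasAsympSymbol))).convergesToAverage

lemma convergesToAverage_belavkinStaszewskiQf (hX : AsympOn (Set.Ioo 0 1) X a)
    (hY : AsympOn (Set.Ioo 0 1) Y b) :
    ConvergesToAverage (fun n => belavkinStaszewskiQf (X n) (Y n))
      fun x => belavkinStaszewskiQf (a x) (b x) :=
  ((hX.one_sub.mlog.hasAsympSymbol.sub hY.one_sub.mlog.hasAsympSymbol).add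
    (hX.hasAsympSymbol.mul ((hX.weight.mpow (1 / 2)).mul_mul
      hY.weight.inv).mlog.hasAsympSymbol)).convergesToAverage

lemma convergesToAverage_renyiDQf (hX : AsympOn (Set.Ioo 0 1) X a)
    (hY : AsympOn (Set.Ioo 0 1) Y b) (α : ℝ) (γ : RenyiIndex) :
    ConvergesToAverage (fun n => renyiDQf α γ (X n) (Y n)) fun x => renyiDQf α γ (a x) (b x) := by
  by_cases hα : α = 1
  · simp only [renyiDQf, if_pos hα]
    cases γ with
    | maximal => exact convergesToAverage_belavkinStaszewskiQf hX hY
    | finite => exact convergesToAverage_umegakiQf hX hY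
    | infinity => exact convergesToAverage_umegakiQf hX hY
  · simp only [renyiDQf, if_neg hα]
    exact (convergesToAverage_psiQf hX hY α γ).const_mul _

lemma asympOn_cutoff {Q : ChainSpace d →L[ℂ] ChainSpace d}
    {q : Torus → Matrix (Fin d) (Fin d) ℂ} (hQ : HasSymbol Q q) (hm : AEStronglyMeasurable q μT)
    {c : ℝ} (hc : c ∈ Set.Ioo (0 : ℝ) (1 / 2))
    (hq : ∀ᵐ x ∂μT, (q x - c • (1 : Matrix (Fin d) (Fin d) ℂ)).PosSemidef ∧
      ((1 - c) • (1 : Matrix (Fin d) (Fin d) ℂ) - q x).PosSemidef) :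
    AsympOn (Set.Ioo 0 1) (fun n => cutoff Q n) q := by
  have hq' : ∀ᵐ x ∂μT, SpecIn (Set.Icc c (1 - c)) (q x) := by
    filter_upwards [hq] with x hx using specIn_Icc_iff.mpr hx
  exact ⟨c, 1 - c, fun t ht => ⟨hc.1.trans_le ht.1, ht.2.trans_lt (by linarith [hc.1])⟩,
    hasAsympSymbol_cutoff hQ hm hq', SpecIn.cutoff hQ hm hq', hq'⟩

end AsympOn

lemma torusAverage_eq_integral (f : Torus → ℝ) : torusAverage f = ∫ x, f x ∂μT := by
  rw [torusAverage, AddCircle.integral_haarAddCircle,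
    ← AddCircle.intervalIntegral_preimage (2 * Real.pi) 0, zero_add, one_div, smul_eq_mul]

lemma torusAverage_congr_ae {f g : Torus → ℝ} (h : f =ᵐ[μT] g) :
    torusAverage f = torusAverage g := by
  rw [torusAverage_eq_integral, torusAverage_eq_integral, integral_congr_ae h]

end
end FermiChain

open FermiChain
theorem mainTheorem1 {d : ℕ}
    (Q R : ChainSpace d →L[ℂ] ChainSpace d)
    (q r : Torus → Matrix (Fin d) (Fin d) ℂ)
    (hq : AEStronglyMeasurable q AddCircle.haarAddCircle)
    (hr : AEStronglyMeasurable r AddCircle.haarAddCircle)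
    (hQ : HasSymbol Q q) (hR : HasSymbol R r)
    (c : ℝ) (hc : c ∈ Set.Ioo (0 : ℝ) (1 / 2))
    (hqc : ∀ᵐ x ∂(AddCircle.haarAddCircle (T := 2 * Real.pi)),
      (q x - c • (1 : Matrix (Fin d) (Fin d) ℂ)).PosSemidef ∧
        ((1 - c) • (1 : Matrix (Fin d) (Fin d) ℂ) - q x).PosSemidef)
    (hrc : ∀ᵐ x ∂(AddCircle.haarAddCircle (T := 2 * Real.pi)),
      (r x - c • (1 : Matrix (Fin d) (Fin d) ℂ)).PosSemidef ∧
        ((1 - c) • (1 : Matrix (Fin d) (Fin d) ℂ) - r x).PosSemidef)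
    (α : ℝ) (hα : 0 < α) (γ : RenyiIndex) :
    -- all integrands are integrable over one period
    (Integrable (fun x => psi α γ (qfDensity (q x)) (qfDensity (r x)))
        (AddCircle.haarAddCircle (T := 2 * Real.pi)) ∧
      Integrable (fun x => renyiD α γ (qfDensity (q x)) (qfDensity (r x)))
        (AddCircle.haarAddCircle (T := 2 * Real.pi))) ∧
    -- the regularized `ψ`
    (HasRegularization (psi α γ) Q R
        (torusAverage fun x => psi α γ (qfDensity (q x)) (qfDensity (r x))) ∧
      torusAverage (fun x => psi α γ (qfDensity (q x)) (qfDensity (r x)))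
        = torusAverage (fun x => psiQf α γ (q x) (r x)) ∧
      torusAverage (fun x => psiQf α γ (q x) (r x))
        = torusAverage (fun x => traceLog α γ (q x) (r x))) ∧
    -- the regularized Rényi divergence
    (HasRegularization (renyiD α γ) Q R
        (torusAverage fun x => renyiD α γ (qfDensity (q x)) (qfDensity (r x))) ∧
      torusAverage (fun x => renyiD α γ (qfDensity (q x)) (qfDensity (r x)))
        = torusAverage (fun x => renyiDQf α γ (q x) (r x)) ∧
      (α ≠ 1 →
        torusAverage (fun x => renyiDQf α γ (q x) (r x))
          = torusAverage (fun x => 1 / (α - 1) * traceLog α γ (q x) (r x)))) := by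
  have hA := asympOn_cutoff hQ hq hc hqc
  have hB := asympOn_cutoff hR hr hc hrc
  obtain ⟨iψ, tψ⟩ := convergesToAverage_psiQf hA hB α γ
  obtain ⟨iD, tD⟩ := convergesToAverage_renyiDQf hA hB α γ
  have eψ : (fun x => psi α γ (qfDensity (q x)) (qfDensity (r x)))
      =ᵐ[AddCircle.haarAddCircle] fun x => psiQf α γ (q x) (r x) := by
    filter_upwards [hA.specIn.2, hB.specIn.2] with x hx hx'
    exact psi_qfDensity α γ hx.1 hx.2 hx'.1 hx'.2
  have eD : (fun x => renyiD α γ (qfDensity (q x)) (qfDensity (r x)))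
      =ᵐ[AddCircle.haarAddCircle] fun x => renyiDQf α γ (q x) (r x) := by
    filter_upwards [hA.specIn.2, hB.specIn.2] with x hx hx'
    exact renyiD_qfDensity α γ hx.1 hx.2 hx'.1 hx'.2
  have eT : (fun x => psiQf α γ (q x) (r x))
      =ᵐ[AddCircle.haarAddCircle] fun x => traceLog α γ (q x) (r x) := by
    filter_upwards [hA.specIn.2, hB.specIn.2] with x hx hx'
    exact traceLog_eq_psiQf α γ hx.1 hx.2 hx'.1 hx'.2
  refine ⟨⟨iψ.congr eψ.symm, iD.congr eD.symm⟩, ⟨?_, torusAverage_congr_ae eψ,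
    torusAverage_congr_ae eT⟩, ⟨?_, torusAverage_congr_ae eD, fun h1 => torusAverage_congr_ae ?_⟩⟩
  · rw [HasRegularization, torusAverage_congr_ae eψ, torusAverage_eq_integral]
    refine tψ.congr fun n => ?_
    congr 1
    have h1 := hA.specIn.1 n
    have h2 := hB.specIn.1 n
    exact (psi_qfDensity α γ h1.1 h1.2 h2.1 h2.2).symm
  · rw [HasRegularization, torusAverage_congr_ae eD, torusAverage_eq_integral]
    refine tD.congr fun n => ?_
    congr 1
    have h1 := hA.specIn.1 n
    have h2 := hB.specIn.1 n
    exact (renyiD_qfDensity α γ h1.1 h1.2 h2.1 h2.2).symm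
  · filter_upwards [eT] with x hx
    simp only [renyiDQf, if_neg h1, hx]
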